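/- **Setting.** Let $\widehat F(\omega)=\int F(t)e^{-2\pi i t\cdot\omega}\,dt$ (extended to $L^2$ by Plancherel), $T_xF(t)=F(t-x)$, and $\langle F,G\rangle=\int F\overline G$. For $1\le p\le\infty$ let $W(L^p,\ell^1)$ be the space of measurable $F:\mathbb R^m\to\mathbb C$ with $\sum_{k\in\mathbb Z^m}\|F\mathbf 1_{k+[0,1]^m}\|_p<\infty$. Let $\mathcal D$ be the set of all $f\in L^2(\mathbb R^m)$ such that $\widehat f\in W(L^\infty,\ell^1)$ and $\widehat f$ has compact support. A bounded continuous $F:\mathbb R^m\to\mathbb C$ is almost periodic if for every $\varepsilon>0$ the set of $\tau$ with $\sup_t|F(t+\tau)-F(t)|\le\varepsilon$ meets all cubes of some fixed side length. The Fourier coefficient of such an $F$ at $\omega\in\mathbb R^m$ is $\lim_{R\to\infty}R^{-m}\int_{x+[0,R]^m}F(t)e^{2\pi i\omega\cdot t}\,dt$ (the limit does not depend on $x\in\mathbb R^m$). Let $\Gamma\subset\mathbb R^m\times\mathbb R$ be a lattice (discrete, of full rank) such that the coordinate projections $p_1:\Gamma\to\mathbb R^m$ and $p_2:\Gamma\to\mathbb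 R$ are both injective with dense image. Let $\mathrm{vol}(\Gamma)$ be its covolume, $\Gamma^*=\{\eta\in\mathbb R^m\times\mathbb R:\gamma\cdot\eta\in\mathbb Z\ \text{for all}\ \gamma\in\Gamma\}$ its dual lattice, and $p_1^*(\eta)\in\mathbb R^m$, $p_2^*(\eta)\in\mathbb R$ the two coordinates of $\eta\in\Gamma^*$. Let $\Omega\subset\mathbb R$ be a compact interval, symmetric around the origin, that is the closure of its interior, and let $\Lambda(\Omega)=\{p_1(\gamma):\gamma\in\Gamma,\ p_2(\gamma)\in\Omega\}$ be the associated simple model set. For a smooth function $\psi:\mathbb R\to\mathbb R$ with support in $\Omega$, put $w_\psi(\lambda)=\psi(p_2(\gamma))$ for $\lambda=p_1(\gamma)\in\Lambda(\Omega)$. **Proposition 3.5.** Let $\Gamma$, $\Omega$ and $\Lambda(\Omega)$ be as above, and let $\psi\ge 0$ be smooth with support in $\Omega$. Let $\mathcal K$ be a countable index set, let $g_k,h_k\in W(L^2,\ell^1)$ for $k\in\mathcal K$, and suppose that for some constants $B_g,B_h>0$ $$\sum_{k\in\mathcal K}|\widehat g_k(t)|^2\le B_g,\qquad \sum_{k\in\mathcal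 K}|\widehat h_k(t)|^2\le B_h\qquad\text{for all } t\in\mathbb R^m .$$ Then, for every $f\in\mathcal D$, the series $$\mathcal N^\psi(x)=\sum_{k\in\mathcal K}\sum_{\lambda\in\Lambda(\Omega)}w_\psi(\lambda)^2\,\langle T_xf,T_\lambda g_k\rangle\,\langle T_\lambda h_k,T_xf\rangle$$ converges absolutely for every $x\in\mathbb R^m$, and $\mathcal N^\psi$ is almost periodic. For every $\eta\in\Gamma^*$, its Fourier coefficient at $p_1^*(\eta)$ is $$\widehat{\mathcal N}^\psi(\eta)=\mathrm{vol}(\Gamma)^{-1}\,\widehat{\psi^2}\bigl(p_2^*(\eta)\bigr)\int_{\mathbb R^m}\widehat f(t)\,\overline{\widehat f(t-p_1^*(\eta))}\Bigl(\sum_{k\in\mathcal K}\overline{\widehat g_k(t)}\,\widehat h_k(t-p_1^*(\eta))\Bigr)dt ,$$ where $\widehat{\psi^2}$ is the Fourier transform of $\psi^2$, and the sum over $k$ (for every $t$) and the integral converge absolutely; its Fourier coefficients at all $\omega\notin p_1^*(\Gamma^*)$ are $0$. Moreover $\mathcal N^\psi$ coincides pointwise with its Fourier series: for every $x\in\mathbb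 R^m$, $$\mathcal N^\psi(x)=\sum_{\eta\in\Gamma^*}\widehat{\mathcal N}^\psi(\eta)\,e^{-2\pi i\,p_1^*(\eta)\cdot x}\qquad\text{with absolute convergence.}$$ -/

import Mathlib

open MeasureTheory Filter Topology
open scoped ENNReal FourierTransform ComplexConjugate

noncomputable section

namespace ModelSetFrames

/-- The closed cube `B(x, R) = R[0,1]^m + x`. -/
def box {m : ℕ} (x : EuclideanSpace ℝ (Fin m)) (R : ℝ) : Set (EuclideanSpace ℝ (Fin m)) :=
  {y | ∀ i, x i ≤ y i ∧ y i ≤ x i + R}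

/-! ### Almost periodic functions -/

/-- `D` is relatively dense: all cubes of some fixed side length meet `D`. -/
def RelativelyDense {m : ℕ} (D : Set (EuclideanSpace ℝ (Fin m))) : Prop :=
  ∃ r : ℝ, 0 < r ∧ ∀ t, (D ∩ box t r).Nonempty

/-- Bohr almost periodicity of a bounded continuous function `ℝ^m → ℂ`. -/
structure AlmostPeriodic {m : ℕ} (F : EuclideanSpace ℝ (Fin m) → ℂ) : Prop where
  continuous : Continuous F
  bounded : ∃ C : ℝ, ∀ t, ‖F t‖ ≤ C
  exists_almost_periods : ∀ ε : ℝ, 0 < ε →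
    ∃ D : Set (EuclideanSpace ℝ (Fin m)), RelativelyDense D ∧
      ∀ τ ∈ D, ∀ t, ‖F (t + τ) - F t‖ ≤ ε

/-- The mean value of `F` exists and equals `a`: the averages over `B(x, R)` tend to `a` as
`R → ∞`, for every `x`. -/
def HasMean {m : ℕ} (F : EuclideanSpace ℝ (Fin m) → ℂ) (a : ℂ) : Prop :=
  ∀ x, Tendsto (fun R : ℝ => ((R : ℂ) ^ m)⁻¹ * ∫ t in box x R, F t) atTop (𝓝 a)

/-- The character `e^{2 π i ω · t}`. -/
def character {m : ℕ} (ω t : EuclideanSpace ℝ (Fin m)) : ℂ :=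
  Complex.exp (2 * Real.pi * Complex.I * (inner ℝ ω t : ℝ))

/-- The Fourier coefficient of the almost periodic function `F` at the frequency `ω`, that is the
mean value of `F(t) e^{2 π i ω · t}`, exists and equals `a`. -/
def HasFourierCoeff {m : ℕ} (F : EuclideanSpace ℝ (Fin m) → ℂ)
    (ω : EuclideanSpace ℝ (Fin m)) (a : ℂ) : Prop :=
  HasMean (fun t => F t * character ω t) a

/-! ### Function spaces -/

/-- The norm of the Wiener amalgam space `W(L^p, ℓ^1)`: the sum over `k ∈ ℤ^m` of the `L^p` norms
of the restrictions to the unit cubes `[0,1]^m + k`. -/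
def wienerNorm {m : ℕ} (p : ℝ≥0∞) (F : EuclideanSpace ℝ (Fin m) → ℂ) : ℝ≥0∞ :=
  ∑' k : Fin m → ℤ,
    eLpNorm ((box (WithLp.toLp 2 fun i => (k i : ℝ)) 1).indicator F) p volume

/-- Membership in the Wiener amalgam space `W(L^p, ℓ^1)`. -/
def MemWiener {m : ℕ} (p : ℝ≥0∞) (F : EuclideanSpace ℝ (Fin m) → ℂ) : Prop :=
  AEStronglyMeasurable F volume ∧ wienerNorm p F < ∞

/-- The Hilbert space `L²(ℝ^m)`. -/
abbrev L2 (m : ℕ) : Type :=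
  Lp ℂ 2 (volume : Measure (EuclideanSpace ℝ (Fin m)))

/-- (A representative of) the Plancherel Fourier transform `f̂` of `f ∈ L²(ℝ^m)`. -/
def fourierL2 {m : ℕ} (f : L2 m) : EuclideanSpace ℝ (Fin m) → ℂ :=
  (𝓕 f : L2 m)

/-- The space `𝒟` of all `f ∈ L²(ℝ^m)` whose (Plancherel) Fourier transform belongs to
`W(L^∞, ℓ^1)` and has compact support. As `𝓕 f` is a class of functions modulo null sets, the
support is understood in the essential sense. -/
def MemD {m : ℕ} (f : L2 m) : Prop :=
  MemWiener ∞ (fourierL2 f) ∧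
    ∃ K : Set (EuclideanSpace ℝ (Fin m)), IsCompact K ∧
      ∀ᵐ t, t ∉ K → fourierL2 f t = 0

/-- Translation `T_x f (t) = f (t - x)`. -/
def translate {m : ℕ} (x : EuclideanSpace ℝ (Fin m)) (F : EuclideanSpace ℝ (Fin m) → ℂ) :
    EuclideanSpace ℝ (Fin m) → ℂ :=
  fun t => F (t - x)

/-- The `L²` inner product, linear in the first argument. -/
def l2Inner {m : ℕ} (F G : EuclideanSpace ℝ (Fin m) → ℂ) : ℂ :=
  ∫ t, F t * conj (G t)

/-! ### Simple model sets -/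

/-- The requirements on a lattice `Γ ⊆ ℝ^m × ℝ` in the construction of model sets (that `Γ` is a
lattice is expressed by `DiscreteTopology Γ` and `IsZLattice ℝ Γ`): both coordinate projections
are injective on `Γ` and have dense image. -/
structure IsCutAndProject {m : ℕ} (Γ : Submodule ℤ (EuclideanSpace ℝ (Fin m) × ℝ)) : Prop where
  injOn_fst : Set.InjOn Prod.fst (Γ : Set (EuclideanSpace ℝ (Fin m) × ℝ))
  injOn_snd : Set.InjOn Prod.snd (Γ : Set (EuclideanSpace ℝ (Fin m) × ℝ))
  dense_fst : Dense (Prod.fst '' (Γ : Set (EuclideanSpace ℝ (Fin m) × ℝ)))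
  dense_snd : Dense (Prod.snd '' (Γ : Set (EuclideanSpace ℝ (Fin m) × ℝ)))

/-- A window of a simple model set that is symmetric around the origin: a compact interval that
is the closure of its interior, with boundary of measure zero, and `-Ω = Ω`. -/
structure IsSymmetricSimpleWindow (Ω : Set ℝ) : Prop where
  isCompact : IsCompact Ω
  closure_interior : closure (interior Ω) = Ω
  volume_frontier : volume (frontier Ω) = 0
  interval : Ω.OrdConnected
  symmetric : ∀ s ∈ Ω, -s ∈ Ω

/-- The dual lattice `Γ* = {η : γ · η ∈ ℤ for all γ ∈ Γ}` for the Euclidean inner product of the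
orthogonal sum `ℝ^m × ℝ`. -/
def dualLattice {m : ℕ} (Γ : Submodule ℤ (EuclideanSpace ℝ (Fin m) × ℝ)) :
    Set (EuclideanSpace ℝ (Fin m) × ℝ) :=
  {η | ∀ γ ∈ Γ, ∃ n : ℤ, inner ℝ γ.1 η.1 + γ.2 * η.2 = n}

/-- The model set `Λ(Ω) = {p₁(γ) : γ ∈ Γ, p₂(γ) ∈ Ω}`. -/
def modelSet {m : ℕ} (Γ : Submodule ℤ (EuclideanSpace ℝ (Fin m) × ℝ)) (Ω : Set ℝ) :
    Set (EuclideanSpace ℝ (Fin m)) :=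
  {l | ∃ γ ∈ Γ, γ.2 ∈ Ω ∧ γ.1 = l}

open Classical in
/-- The weight `w_ψ(λ) = ψ(p₂(γ))` for `λ = p₁(γ) ∈ Λ(Ω)`, and `w_ψ(λ) = 0` for `λ ∉ Λ(Ω)`.
The point `γ` is unique, since `p₁` is injective on `Γ`. -/
def weight {m : ℕ} (Γ : Submodule ℤ (EuclideanSpace ℝ (Fin m) × ℝ)) (Ω : Set ℝ) (ψ : ℝ → ℝ)
    (l : EuclideanSpace ℝ (Fin m)) : ℝ :=
  if h : l ∈ modelSet Γ Ω then ψ h.choose.2 else 0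

theorem weight_fst {m : ℕ} {Γ : Submodule ℤ (EuclideanSpace ℝ (Fin m) × ℝ)}
    (hΓ : IsCutAndProject Γ) {Ω : Set ℝ} {ψ : ℝ → ℝ} {γ : EuclideanSpace ℝ (Fin m) × ℝ}
    (hγ : γ ∈ Γ) (hγΩ : γ.2 ∈ Ω) : weight Γ Ω ψ γ.1 = ψ γ.2 := by
  have h : γ.1 ∈ modelSet Γ Ω := ⟨γ, hγ, hγΩ, rfl⟩
  have hc := h.choose_spec
  rw [weight, dif_pos h, hΓ.injOn_fst hc.1 hγ hc.2.2]

/-- The space `C₀^∞(Ω)` of real-valued smooth functions on `ℝ` with support in `Ω`. -/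
structure IsSmoothSupportedIn (ψ : ℝ → ℝ) (Ω : Set ℝ) : Prop where
  contDiff : ContDiff ℝ ((⊤ : ℕ∞) : WithTop ℕ∞) ψ
  tsupport_subset : tsupport ψ ⊆ Ω

/-! ### The weighted function and its coefficients -/

/-- The term of index `(k, l)` of the series defining `𝒩^ψ(x)`, for `g = g_k` and `h = h_k`:
`w_ψ(l)² ⟨T_x f, T_l g⟩ ⟨T_l h, T_x f⟩`. -/
def seriesTerm {m : ℕ} (Γ : Submodule ℤ (EuclideanSpace ℝ (Fin m) × ℝ)) (Ω : Set ℝ) (ψ : ℝ → ℝ)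
    (f g h : EuclideanSpace ℝ (Fin m) → ℂ) (x l : EuclideanSpace ℝ (Fin m)) : ℂ :=
  ((weight Γ Ω ψ l ^ 2 : ℝ) : ℂ) * l2Inner (translate x f) (translate l g) *
    l2Inner (translate l h) (translate x f)

/-- The function
`𝒩^ψ(x) = ∑_k ∑_{l ∈ Λ(Ω)} w_ψ(l)² ⟨T_x f, T_l g_k⟩ ⟨T_l h_k, T_x f⟩`. -/
def weightedFun {m : ℕ} {K : Type*} (Γ : Submodule ℤ (EuclideanSpace ℝ (Fin m) × ℝ))
    (Ω : Set ℝ) (ψ : ℝ → ℝ) (f : EuclideanSpace ℝ (Fin m) → ℂ)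
    (g h : K → EuclideanSpace ℝ (Fin m) → ℂ) (x : EuclideanSpace ℝ (Fin m)) : ℂ :=
  ∑' k : K, ∑' l : modelSet Γ Ω, seriesTerm Γ Ω ψ f (g k) (h k) x l

/-- The integrand
`f̂(t) conj(f̂(t - ω)) ∑_k conj(ĝ_k(t)) ĥ_k(t - ω)`, where `fhat` stands for `f̂`. -/
def coeffIntegrand {m : ℕ} {K : Type*} (fhat : EuclideanSpace ℝ (Fin m) → ℂ)
    (g h : K → EuclideanSpace ℝ (Fin m) → ℂ) (ω t : EuclideanSpace ℝ (Fin m)) : ℂ :=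
  fhat t * conj (fhat (t - ω)) * ∑' k : K, conj (𝓕 (g k) t) * 𝓕 (h k) (t - ω)

/-- The coefficient
`vol(Γ)⁻¹ (ψ²)^(p₂*(η)) ∫ f̂(t) conj(f̂(t - p₁*(η))) ∑_k conj(ĝ_k(t)) ĥ_k(t - p₁*(η)) dt`,
where `(ψ²)^` is the Fourier transform of the function `ψ²`. -/
def coeff {m : ℕ} {K : Type*} (Γ : Submodule ℤ (EuclideanSpace ℝ (Fin m) × ℝ)) (ψ : ℝ → ℝ)
    (fhat : EuclideanSpace ℝ (Fin m) → ℂ) (g h : K → EuclideanSpace ℝ (Fin m) → ℂ)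
    (η : EuclideanSpace ℝ (Fin m) × ℝ) : ℂ :=
  ((ZLattice.covolume Γ volume : ℝ) : ℂ)⁻¹ * 𝓕 (fun s : ℝ => ((ψ s ^ 2 : ℝ) : ℂ)) η.2 *
    ∫ t, coeffIntegrand fhat g h η.1 t

end ModelSetFrames

end

/-! By Parseval, `⟨T_x f, T_λ g_k⟩` is the value at `λ - x` of the inverse Fourier transform of `u_k
= f̂ · conj ĝ_k`; similarly for `v_k = f̂ · conj ĥ_k`. If `γ ∈ Γ` lies above `λ`, the term of index
`(k, λ)` is therefore the value at `γ - (x, 0)` of the function `(𝓕⁻ u_k · conj (𝓕⁻ v_k)) ⊗ ψ²` on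
`ℝ^m × ℝ`. Since `ψ` vanishes off `Ω`, the sum over the model set is a sum over the whole lattice,
and Poisson summation (`LocallySummable.hasSum_poisson`, `hasSum_bandCoeff`) turns it into a series
over `Γ*`. The first factor contributes the correlation `∫ u_k(t) conj(v_k(t - p₁*(η))) dt`, the
second `(ψ²)^(p₂*(η))`, and the shift by `(x, 0)` the character. Summation over `k` gives the stated
coefficients.

Absolute convergence comes from the compact support of `f̂`. On the lattice side, a function with
spectrum in a fixed compact set has square-summable samples along a strip of `Γ`, with a bound
proportional to its energy (`exists_sampling_bound`). On the dual side, the correlations vanish for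
large `p₁*(η)` while `(ψ²)^` decays rapidly in `p₂*(η)`, so `Γ*` is effectively summed over a slab.
Both constants are uniform in `k`, and `∑_k ∫ |u_k|² ≤ B_g ∫ |f̂|²`, which makes the double series
absolutely summable.

Given the absolutely convergent series, means may be taken term by term, and `p₁*` is injective on
`Γ*` because `p₂(Γ)` is dense, so each frequency receives one coefficient. For `γ ∈ Γ` and `η ∈ Γ*`
one has `e^{-2πi p₁*(η)·p₁(γ)} = e^{2πi p₂*(η) p₂(γ)}`, so lattice points with small `p₂(γ)` give
almost periods `p₁(γ)`. -/

noncomputable section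

namespace ModelSetFrames

open Module

/-! ### Poisson summation for lattices -/

set_option linter.unusedSectionVars false

section Poisson

variable {V : Type*} [NormedAddCommGroup V] [NormedSpace ℝ V] [FiniteDimensional ℝ V]
  [MeasurableSpace V] [BorelSpace V]
  {ι : Type*} [Fintype ι]

/-- The sums of `‖F‖` over the translates of the lattice `L` converge locally uniformly. -/
def LocallySummable (L : Submodule ℤ V) (F : V → ℂ) : Prop :=
  ∀ R : ℝ, ∃ c : L → ℝ, Summable c ∧ ∀ (γ : L) (v : V), ‖v‖ ≤ R → ‖F (v + γ)‖ ≤ c γ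

variable {L : Submodule ℤ V} [DiscreteTopology L] [IsZLattice ℝ L] {F : V → ℂ}

theorem LocallySummable.exists_fundamentalDomain (b : Basis ι ℤ L) (h : LocallySummable L F) :
    ∃ c : L → ℝ, Summable c ∧ (∀ γ, 0 ≤ c γ) ∧
      ∀ (γ : L), ∀ v ∈ ZSpan.fundamentalDomain (b.ofZLatticeBasis ℝ), ‖F (v + γ)‖ ≤ c γ := by
  obtain ⟨R, hR⟩ := (ZSpan.fundamentalDomain_isBounded (b.ofZLatticeBasis ℝ)).exists_norm_le
  obtain ⟨c, hc, hcF⟩ := h (max R 0)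
  -- The radius is `max R 0` so that the origin lies in the ball; evaluation there shows that the
  -- majorant is nonnegative.
  refine ⟨c, hc, fun γ => (norm_nonneg _).trans (hcF γ 0 (by simp)), fun γ v hv => ?_⟩
  exact hcF γ v ((hR v hv).trans (le_max_left _ _))

theorem measure_fundamentalDomain_lt_top (b : Basis ι ℝ V) (μ : Measure V) [μ.IsAddHaarMeasure] :
    μ (ZSpan.fundamentalDomain b) < ∞ :=
  (ZSpan.fundamentalDomain_isBounded b).measure_lt_top

theorem LocallySummable.integrable (h : LocallySummable L F) (hF : Continuous F)
    (μ : Measure V) [μ.IsAddHaarMeasure] : Integrable F μ := by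
  have : Module.Finite ℤ L := ZLattice.module_finite ℝ L
  have : Module.Free ℤ L := ZLattice.module_free ℝ L
  let b := Free.chooseBasis ℤ L
  obtain ⟨c, hc, hc0, hcF⟩ := h.exists_fundamentalDomain b
  refine ⟨hF.aestronglyMeasurable, ?_⟩
  have hD := ZLattice.isAddFundamentalDomain b μ
  have : MeasurableVAdd L V := (inferInstance : MeasurableVAdd L.toAddSubgroup V)
  have : VAddInvariantMeasure L V μ := (inferInstance : VAddInvariantMeasure L.toAddSubgroup V μ)
  rw [HasFiniteIntegral, hD.lintegral_eq_tsum'' (fun x => ‖F x‖ₑ)]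
  set D := ZSpan.fundamentalDomain (b.ofZLatticeBasis ℝ)
  have hDm : MeasurableSet D := ZSpan.fundamentalDomain_measurableSet _
  calc _ ≤ ∑' γ : L, ENNReal.ofReal (c γ) * μ D := by
        refine ENNReal.tsum_le_tsum fun γ => ?_
        rw [← setLIntegral_const]
        refine setLIntegral_mono measurable_const fun v hv => ?_
        rw [← ofReal_norm]
        refine ENNReal.ofReal_le_ofReal ?_
        have := hcF γ v hv
        rwa [add_comm] at this
    _ = (∑' γ : L, ENNReal.ofReal (c γ)) * μ D := ENNReal.tsum_mul_right
    _ < ∞ := by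
        refine ENNReal.mul_lt_top ?_ (measure_fundamentalDomain_lt_top _ μ)
        rw [← ENNReal.ofReal_tsum_of_nonneg hc0 hc]
        exact ENNReal.ofReal_lt_top

/-- Unfolding an integral over a fundamental domain of the periodization. -/
theorem LocallySummable.setIntegral_tsum (h : LocallySummable L F) (hF : Continuous F)
    (b : Basis ι ℤ L) (μ : Measure V) [μ.IsAddHaarMeasure] :
    ∫ v in ZSpan.fundamentalDomain (b.ofZLatticeBasis ℝ), ∑' γ : L, F (v + γ) ∂μ
      = ∫ v, F v ∂μ := by
  obtain ⟨c, hc, hc0, hcF⟩ := h.exists_fundamentalDomain b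
  have hD := ZLattice.isAddFundamentalDomain b μ
  have : MeasurableVAdd L V := (inferInstance : MeasurableVAdd L.toAddSubgroup V)
  have : VAddInvariantMeasure L V μ := (inferInstance : VAddInvariantMeasure L.toAddSubgroup V μ)
  rw [hD.integral_eq_tsum'' _ (h.integrable hF μ)]
  set D := ZSpan.fundamentalDomain (b.ofZLatticeBasis ℝ)
  have hDm : MeasurableSet D := ZSpan.fundamentalDomain_measurableSet _
  have hDlt := measure_fundamentalDomain_lt_top (b.ofZLatticeBasis ℝ) μ
  rw [integral_tsum (f := fun (γ : L) v => F (v + γ))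
    (fun γ => (by fun_prop : Continuous fun v : V => F (v + γ)).aestronglyMeasurable)]
  · refine tsum_congr fun γ => integral_congr_ae (Eventually.of_forall fun v => ?_)
    simp [Submodule.vadd_def, add_comm]
  · refine ne_top_of_le_ne_top (b := (∑' γ : L, ENNReal.ofReal (c γ)) * μ D) ?_ ?_
    · refine (ENNReal.mul_lt_top ?_ hDlt).ne
      rw [← ENNReal.ofReal_tsum_of_nonneg hc0 hc]
      exact ENNReal.ofReal_lt_top
    · rw [← ENNReal.tsum_mul_right]
      refine ENNReal.tsum_le_tsum fun γ => ?_
      rw [← setLIntegral_const]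
      refine setLIntegral_mono measurable_const fun v hv => ?_
      rw [← ofReal_norm]
      exact ENNReal.ofReal_le_ofReal (hcF γ v hv)

theorem LocallySummable.continuous_tsum (h : LocallySummable L F) (hF : Continuous F) :
    Continuous fun v => ∑' γ : L, F (v + γ) := by
  refine continuous_iff_continuousAt.2 fun v₀ => ?_
  obtain ⟨c, hc, hcF⟩ := h (‖v₀‖ + 1)
  have : ContinuousOn (fun v => ∑' γ : L, F (v + γ)) (Metric.ball v₀ 1) := by
    refine continuousOn_tsum (fun γ => (by fun_prop : Continuous fun v => F (v + γ)).continuousOn)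
      hc fun γ v hv => hcF γ v ?_
    have h1 : ‖v - v₀‖ < 1 := by simpa [dist_eq_norm] using hv
    have h2 := norm_sub_norm_le v v₀
    linarith
  exact this.continuousAt (Metric.ball_mem_nhds v₀ one_pos)

theorem LocallySummable.mul_bounded (h : LocallySummable L F) {e : V → ℂ} (he : ∀ v, ‖e v‖ ≤ 1) :
    LocallySummable L fun v => e v * F v := by
  intro R
  obtain ⟨c, hc, hcF⟩ := h R
  refine ⟨c, hc, fun γ v hv => ?_⟩
  rw [norm_mul]
  exact (mul_le_of_le_one_left (norm_nonneg _) (he _)).trans (hcF γ v hv)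

/-- The character `e^{-2 π i ∑ nᵢ vᵢ}` in the coordinates `vᵢ` of the basis `B`. -/
def basisChar (B : Basis ι ℝ V) (n : ι → ℤ) (v : V) : ℂ :=
  Complex.exp (-(2 * Real.pi * Complex.I * ((∑ i, n i * B.repr v i : ℝ) : ℂ)))

theorem continuous_basisChar (B : Basis ι ℝ V) (n : ι → ℤ) : Continuous (basisChar B n) := by
  have : ∀ i, Continuous fun v => B.repr v i := fun i =>
    (B.coord i).continuous_of_finiteDimensional
  unfold basisChar
  fun_prop

theorem norm_basisChar (B : Basis ι ℝ V) (n : ι → ℤ) (v : V) : ‖basisChar B n v‖ = 1 := by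
  rw [basisChar, show -(2 * (Real.pi : ℂ) * Complex.I * ((∑ i, n i * B.repr v i : ℝ) : ℂ))
    = ((-(2 * Real.pi * (∑ i, n i * B.repr v i)) : ℝ) : ℂ) * Complex.I by push_cast; ring]
  exact Complex.norm_exp_ofReal_mul_I _

theorem basisChar_add_lattice (b : Basis ι ℤ L) (n : ι → ℤ) (v : V) (γ : L) :
    basisChar (b.ofZLatticeBasis ℝ) n (v + γ) = basisChar (b.ofZLatticeBasis ℝ) n v := by
  rw [basisChar, basisChar, Complex.exp_eq_exp_iff_exists_int]
  refine ⟨-∑ i, n i * b.repr γ i, ?_⟩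
  simp only [map_add, Finsupp.add_apply, Basis.ofZLatticeBasis_repr_apply, mul_add,
    Finset.sum_add_distrib]
  push_cast
  ring

/-- The image of Lebesgue measure is a Haar measure, hence a multiple of `μ`. The factor is found on
the fundamental domain, whose preimage is the unit cube. -/
theorem measurePreserving_basis (b : Basis ι ℤ L) (μ : Measure V) [μ.IsAddHaarMeasure] :
    MeasurePreserving (b.ofZLatticeBasis ℝ).equivFunL.symm volume
      ((ENNReal.ofReal (ZLattice.covolume L μ))⁻¹ • μ) := by
  set B := b.ofZLatticeBasis ℝ
  refine ⟨B.equivFunL.symm.continuous.measurable, ?_⟩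
  have h1 : (Measure.map B.equivFunL.symm volume).IsAddHaarMeasure :=
    B.equivFunL.symm.isAddHaarMeasure_map volume
  have h2 := Measure.isAddLeftInvariant_eq_smul (Measure.map B.equivFunL.symm volume) μ
  have hDm : MeasurableSet (ZSpan.fundamentalDomain B) := ZSpan.fundamentalDomain_measurableSet _
  have h3 : Measure.map B.equivFunL.symm volume (ZSpan.fundamentalDomain B) = 1 := by
    rw [Measure.map_apply B.equivFunL.symm.continuous.measurable hDm]
    have : B.equivFunL.symm ⁻¹' (ZSpan.fundamentalDomain B)
        = Set.pi Set.univ fun _ : ι => Set.Ico (0 : ℝ) 1 := by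
      ext c
      simp only [Set.mem_preimage, ZSpan.mem_fundamentalDomain, Set.mem_pi, Set.mem_univ,
        forall_const]
      have : ∀ i, B.repr (B.equivFunL.symm c) i = c i := fun i => by
        have := congrFun (B.equivFunL.apply_symm_apply c) i
        simpa using this
      simp only [this]
    rw [this, Real.volume_pi_Ico]
    simp
  have h4 : ENNReal.ofReal (ZLattice.covolume L μ) = μ (ZSpan.fundamentalDomain B) := by
    rw [ZLattice.covolume_eq_measure_fundamentalDomain L μ (ZLattice.isAddFundamentalDomain b μ),
      Measure.real, ENNReal.ofReal_toReal (measure_fundamentalDomain_lt_top B μ).ne]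
  rw [h2, Measure.smul_apply] at h3
  rw [h2, h4, ← ENNReal.eq_inv_of_mul_eq_one_left (by simpa [ENNReal.smul_def] using h3)]
  rfl

/-- **Poisson summation** for a lattice in a finite-dimensional space. -/
theorem LocallySummable.hasSum_poisson (h : LocallySummable L F) (hF : Continuous F)
    (b : Basis ι ℤ L) (μ : Measure V) [μ.IsAddHaarMeasure]
    (hs : Summable fun n : ι → ℤ => ∫ v, basisChar (b.ofZLatticeBasis ℝ) n v * F v ∂μ) :
    HasSum (fun n : ι → ℤ => ((ZLattice.covolume L μ : ℝ) : ℂ)⁻¹ *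
      ∫ v, basisChar (b.ofZLatticeBasis ℝ) n v * F v ∂μ) (∑' γ : L, F γ) := by
  classical
  set B := b.ofZLatticeBasis ℝ with hB
  set A := B.equivFunL.symm with hA
  have hAc : ∀ c, A c = ∑ i, c i • B i := fun c => B.equivFun_symm_apply c
  have hAint : ∀ k : ι → ℤ, A (fun i => (k i : ℝ)) ∈ L := by
    intro k
    have : A (fun i => (k i : ℝ)) = ((∑ i, k i • b i : L) : V) := by
      rw [hAc]
      simp [hB, Int.cast_smul_eq_zsmul]
    rw [this]
    exact Subtype.mem _
  have hrepr : ∀ c i, B.repr (A c) i = c i := fun c i =>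
    congrFun (B.equivFun.apply_symm_apply c) i
  set P : V → ℂ := fun v => ∑' γ : L, F (v + γ) with hP
  have hPper : ∀ v, ∀ γ ∈ L, P (v + γ) = P v := by
    intro v γ hγ
    rw [hP]
    simp only [add_assoc]
    exact (Equiv.addLeft (⟨γ, hγ⟩ : L)).tsum_eq fun γ' : L => F (v + γ')
  have hPc : Continuous P := h.continuous_tsum hF
  -- In the coordinates of the basis, `P` is periodic under `ℤ^ι` and descends to a continuous
  -- function `Q` on the torus. Poisson summation is the Fourier series of `Q` at the origin, which
  -- converges there because the coefficients are summable.
  let π : (ι → ℝ) → UnitAddTorus ι := fun c i => (c i : UnitAddCircle)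
  have hπ : IsOpenQuotientMap π := by
    refine ⟨?_, by fun_prop, ?_⟩
    · intro t
      choose c hc using fun i => QuotientAddGroup.mk_surjective (t i)
      exact ⟨c, funext hc⟩
    · exact IsOpenMap.piMap (fun i => QuotientAddGroup.isOpenMap_coe) (by simp)
  have hPπ : ∀ c c', π c = π c' → P (A c) = P (A c') := by
    intro c c' hcc
    have : ∀ i, ∃ k : ℤ, c i = c' i + k := by
      intro i
      have := congrFun hcc i
      simp only [π] at this
      rw [← sub_eq_zero, ← AddCircle.coe_sub, AddCircle.coe_eq_zero_iff] at this
      obtain ⟨k, hk⟩ := this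
      exact ⟨k, by simp at hk; linarith⟩
    choose k hk using this
    have : A c = A c' + A (fun i => (k i : ℝ)) := by
      rw [← map_add]
      congr 1
      exact funext hk
    rw [this, hPper _ _ (hAint k)]
  let PA : C(ι → ℝ, ℂ) := ⟨fun c => P (A c), hPc.comp A.continuous⟩
  let Q : C(UnitAddTorus ι, ℂ) := IsQuotientMap.lift (f := ⟨π, hπ.continuous⟩) hπ.isQuotientMap PA (fun c c' => hPπ c c')
  have hQ : ∀ c, Q (π c) = P (A c) := fun c =>
    DFunLike.congr_fun (IsQuotientMap.lift_comp (f := ⟨π, hπ.continuous⟩) hπ.isQuotientMap PA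
      (fun c c' => hPπ c c')) c
  have hcoeff : ∀ n : ι → ℤ, UnitAddTorus.mFourierCoeff Q n
      = ((ZLattice.covolume L μ : ℝ) : ℂ)⁻¹ * ∫ v, basisChar B n v * F v ∂μ := by
    intro n
    set D := ZSpan.fundamentalDomain B with hD
    have hDm : MeasurableSet D := ZSpan.fundamentalDomain_measurableSet _
    have hpre : A ⁻¹' D = Set.pi Set.univ fun _ : ι => Set.Ico (0 : ℝ) 1 := by
      ext c
      simp [hD, ZSpan.mem_fundamentalDomain, hrepr]
    have hchar : ∀ c, UnitAddTorus.mFourier (-n) (π c) = basisChar B n (A c) := by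
      intro c
      simp only [UnitAddTorus.mFourier, π, ContinuousMap.coe_mk, fourier_coe_apply, basisChar,
        hrepr, ← Complex.exp_sum]
      congr 1
      push_cast
      rw [Finset.mul_sum, ← Finset.sum_neg_distrib]
      refine Finset.sum_congr rfl fun i _ => ?_
      simp
      ring
    have hperiod : ∀ v, basisChar B n v * P v
        = ∑' γ : L, (fun v => basisChar B n v * F v) (v + γ) := by
      intro v
      simp only [hB, basisChar_add_lattice, hP]
      rw [tsum_mul_left]
    rw [UnitAddTorus.mFourierCoeff_eq_integral _ n 0]
    have hIoc : {x : ι → ℝ | ∀ i, x i ∈ Set.Ioc ((0 : ι → ℝ) i) ((0 : ι → ℝ) i + 1)}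
        = Set.pi Set.univ fun _ : ι => Set.Ioc (0 : ℝ) 1 := by
      ext x; simp
    -- The torus integral runs over `(0,1]^ι`, the fundamental domain is `[0,1)^ι`; they differ by a
    -- null set.
    have hae : (Set.pi Set.univ fun _ : ι => Set.Ioc (0 : ℝ) 1) =ᵐ[(volume : Measure (ι → ℝ))]
        (Set.pi Set.univ fun _ : ι => Set.Ico (0 : ℝ) 1) :=
      (Measure.univ_pi_Ioc_ae_eq_Icc (μ := fun _ : ι => (volume : Measure ℝ))
        (f := fun _ => 0) (g := fun _ => 1)).trans Measure.univ_pi_Ico_ae_eq_Icc.symm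
    rw [hIoc, setIntegral_congr_set hae, ← hpre]
    have hmp := measurePreserving_basis b μ
    have hemb : MeasurableEmbedding A := A.toHomeomorph.measurableEmbedding
    have h1 := hmp.setIntegral_preimage_emb hemb (fun v => basisChar B n v * P v) D
    have h2 := (h.mul_bounded (fun v => (norm_basisChar B n v).le)).setIntegral_tsum
      ((continuous_basisChar B n).mul hF) b μ
    simp only [← hperiod] at h2
    rw [← h2]
    rw [Measure.restrict_smul, integral_smul_measure] at h1
    convert h1 using 1
    · refine integral_congr_ae (Eventually.of_forall fun c => ?_)
      exact congrArg₂ (· * ·) (hchar c) (hQ c)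
    · rw [ENNReal.toReal_inv, ENNReal.toReal_ofReal (ZLattice.covolume_pos L μ).le]
      rw [Complex.real_smul, Complex.ofReal_inv]
  have hsQ : Summable (UnitAddTorus.mFourierCoeff Q) := by
    rw [funext hcoeff]
    exact hs.mul_left _
  have := UnitAddTorus.hasSum_mFourier_series_apply_of_summable hsQ (π 0)
  rw [hQ, map_zero] at this
  simp only [hcoeff] at this
  have h0 : ∀ n : ι → ℤ, UnitAddTorus.mFourier n (π 0) = 1 := by
    intro n
    simp [UnitAddTorus.mFourier, π]
  simpa [h0, hP] using this

end Poisson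

/-! ### The Fourier transform on `L¹ ∩ L²` -/

section Plancherel

variable {V : Type*} [NormedAddCommGroup V] [InnerProductSpace ℝ V] [FiniteDimensional ℝ V]
  [MeasurableSpace V] [BorelSpace V]

theorem continuous_fourier {f : V → ℂ} (hf : Integrable f) : Continuous (𝓕 f) :=
  VectorFourier.fourierIntegral_continuous Real.continuous_fourierChar
    (innerSL ℝ).continuous₂ hf

theorem integral_fourier_mul_eq {f g : V → ℂ} (hf : Integrable f) (hg : Integrable g) :
    ∫ ξ, 𝓕 f ξ * g ξ = ∫ x, f x * 𝓕 g x := by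
  have := VectorFourier.integral_fourierIntegral_smul_eq_flip (L := innerₗ V)
    (μ := (volume : Measure V)) (ν := (volume : Measure V))
    Real.continuous_fourierChar (innerSL ℝ).continuous₂ hf hg
  rw [flip_innerₗ] at this
  exact this

/-- The Plancherel transform of a function in `L¹ ∩ L²` is given by the Fourier integral. -/
theorem fourier_toLp_ae_eq {f : V → ℂ} (h1 : Integrable f) (h2 : MemLp f 2) :
    ((𝓕 h2.toLp : Lp ℂ 2 (volume : Measure V)) : V → ℂ) =ᵐ[volume] 𝓕 f := by
  refine ae_eq_of_integral_contDiff_smul_eq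
    ((Lp.memLp (𝓕 h2.toLp : Lp ℂ 2 (volume : Measure V))).locallyIntegrable (by norm_num))
    (continuous_fourier h1).locallyIntegrable fun g hg hgc => ?_
  have hg₁ : HasCompactSupport (Complex.ofRealCLM ∘ g) := hgc.comp_left rfl
  have hg₂ : ContDiff ℝ ((⊤ : ℕ∞) : WithTop ℕ∞) (Complex.ofRealCLM ∘ g) := by fun_prop
  -- Tested against `G`, the distributional transform of `f` moves onto `G`; the multiplication
  -- formula for integrable functions moves it back, now as the Fourier integral of `f`.
  set G := hg₁.toSchwartzMap hg₂ with hG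
  have hGa : ∀ x, G x = (g x : ℂ) := fun x => rfl
  have e1 : (Lp.toTemperedDistribution (𝓕 h2.toLp : Lp ℂ 2 (volume : Measure V))) G
      = (Lp.toTemperedDistribution (h2.toLp : Lp ℂ 2 (volume : Measure V))) (𝓕 G) := by
    rw [← Lp.fourier_toTemperedDistribution_eq, TemperedDistribution.fourier_apply]
  rw [Lp.toTemperedDistribution_apply, Lp.toTemperedDistribution_apply] at e1
  simp only [hGa, smul_eq_mul] at e1
  simp only [Complex.real_smul]
  rw [e1]
  have e2 : ∫ x, (𝓕 G) x * (h2.toLp : V → ℂ) x = ∫ x, 𝓕 (G : V → ℂ) x * f x := by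
    refine integral_congr_ae ?_
    filter_upwards [h2.coeFn_toLp] with x hx
    rw [hx, SchwartzMap.fourier_coe]
  rw [e2, integral_fourier_mul_eq G.integrable h1]
  rfl

theorem memLp_fourier {f : V → ℂ} (h1 : Integrable f) (h2 : MemLp f 2) : MemLp (𝓕 f) 2 :=
  (memLp_congr_ae (fourier_toLp_ae_eq h1 h2)).1 (Lp.memLp _)

theorem integral_mul_conj_fourier_Lp (F : Lp ℂ 2 (volume : Measure V)) {g : V → ℂ}
    (h1 : Integrable g) (h2 : MemLp g 2) :
    ∫ t, (F : V → ℂ) t * conj (g t)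
      = ∫ t, ((𝓕 F : Lp ℂ 2 (volume : Measure V)) : V → ℂ) t * conj (𝓕 g t) := by
  have h := Lp.inner_fourier_eq (h2.toLp : Lp ℂ 2 (volume : Measure V)) F
  rw [L2.inner_def, L2.inner_def] at h
  simp only [RCLike.inner_apply] at h
  rw [integral_congr_ae (g := fun t => (F : V → ℂ) t * conj ((h2.toLp : V → ℂ) t)),  ← h]
  · refine integral_congr_ae ?_
    filter_upwards [fourier_toLp_ae_eq h1 h2] with t ht
    rw [ht]
  · filter_upwards [h2.coeFn_toLp] with t ht
    rw [ht]

theorem integral_mul_conj_fourier {f g : V → ℂ} (hf1 : Integrable f) (hf2 : MemLp f 2)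
    (hg1 : Integrable g) (hg2 : MemLp g 2) :
    ∫ t, 𝓕 f t * conj (𝓕 g t) = ∫ t, f t * conj (g t) := by
  have h := integral_mul_conj_fourier_Lp (hf2.toLp : Lp ℂ 2 (volume : Measure V)) hg1 hg2
  have h1 : ∫ t, (hf2.toLp : V → ℂ) t * conj (g t) = ∫ t, f t * conj (g t) := by
    refine integral_congr_ae ?_
    filter_upwards [hf2.coeFn_toLp] with t ht
    rw [ht]
  have h2 : ∫ t, ((𝓕 hf2.toLp : Lp ℂ 2 (volume : Measure V)) : V → ℂ) t * conj (𝓕 g t)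
      = ∫ t, 𝓕 f t * conj (𝓕 g t) := by
    refine integral_congr_ae ?_
    filter_upwards [fourier_toLp_ae_eq hf1 hf2] with t ht
    rw [ht]
  rw [← h1, ← h2, h]

theorem integral_norm_sq_fourier {f : V → ℂ} (hf1 : Integrable f) (hf2 : MemLp f 2) :
    ∫ t, ‖𝓕 f t‖ ^ 2 = ∫ t, ‖f t‖ ^ 2 := by
  have h := integral_mul_conj_fourier hf1 hf2 hf1 hf2
  simp only [RCLike.mul_conj, ← RCLike.ofReal_pow] at h
  rw [integral_ofReal, integral_ofReal] at h
  exact_mod_cast h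

theorem fourier_comp_add_right (f : V → ℂ) (v₀ w : V) :
    𝓕 (fun v => f (v + v₀)) w = Real.fourierChar (inner ℝ v₀ w) • 𝓕 f w :=
  congrFun (VectorFourier.fourierIntegral_comp_add_right Real.fourierChar volume (innerₗ V) f v₀) w

theorem fourierInv_comp_sub_right (f : V → ℂ) (v₀ w : V) :
    𝓕⁻ (fun v => f (v - v₀)) w = Real.fourierChar (inner ℝ v₀ w) • 𝓕⁻ f w := by
  simp only [Real.fourierInv_eq_fourier_neg, sub_eq_add_neg]
  rw [fourier_comp_add_right]
  simp

/-- The inverse Fourier transforms of two functions multiply to a function whose Fourier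
transform is their correlation. -/
theorem fourier_mul_conj_fourierInv {u v : V → ℂ} (hu1 : Integrable u) (hu2 : MemLp u 2)
    (hv1 : Integrable v) (hv2 : MemLp v 2) (ω : V) :
    𝓕 (fun y => 𝓕⁻ u y * conj (𝓕⁻ v y)) ω = ∫ t, u t * conj (v (t - ω)) := by
  have hv1' : Integrable fun t => v (t - ω) := hv1.comp_sub_right ω
  have hv2' : MemLp (fun t => v (t - ω)) 2 :=
    hv2.comp_measurePreserving (measurePreserving_sub_right volume ω)
  -- After Parseval, translation by `ω` has become a modulation, which serves as the Fourier kernel;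
  -- the reflection `t ↦ -t` exchanges `𝓕` and `𝓕⁻`.
  rw [← integral_mul_conj_fourier hu1 hu2 hv1' hv2', Real.fourier_eq,
    ← integral_neg_eq_self (fun t => 𝓕 u t * conj (𝓕 (fun t => v (t - ω)) t))]
  refine integral_congr_ae (Eventually.of_forall fun y => ?_)
  simp only [← Real.fourierInv_eq_fourier_neg, fourierInv_comp_sub_right, Circle.smul_def,
    smul_eq_mul, map_mul]
  rw [← Circle.coe_inv_eq_conj, ← AddChar.map_neg_eq_inv, real_inner_comm]
  ring

end Plancherel

/-! ### Cubes and amalgam spaces -/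

section Wiener

variable {m : ℕ}

theorem box_eq_preimage (x : EuclideanSpace ℝ (Fin m)) (R : ℝ) :
    box x R = (MeasurableEquiv.toLp 2 (Fin m → ℝ)).symm ⁻¹'
      (Set.pi Set.univ fun i => Set.Icc (x i) (x i + R)) := by
  ext y
  simp only [box, Set.mem_ofPred_eq, Set.mem_preimage, Set.mem_pi, Set.mem_univ, forall_const,
    Set.mem_Icc]
  rfl

theorem measurableSet_box (x : EuclideanSpace ℝ (Fin m)) (R : ℝ) : MeasurableSet (box x R) := by
  rw [box_eq_preimage]
  exact (MeasurableEquiv.measurable _)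
    (MeasurableSet.univ_pi fun i => measurableSet_Icc)

theorem volume_box (x : EuclideanSpace ℝ (Fin m)) (R : ℝ) : volume (box x R) = ENNReal.ofReal R ^ m := by
  rw [box_eq_preimage,
    (EuclideanSpace.volume_preserving_symm_measurableEquiv_toLp (Fin m)).measure_preimage
      (MeasurableSet.univ_pi fun i => measurableSet_Icc).nullMeasurableSet, volume_pi_pi]
  simp

theorem iUnion_box_eq_univ :
    ⋃ k : Fin m → ℤ, box (WithLp.toLp 2 fun i => (k i : ℝ) : EuclideanSpace ℝ (Fin m)) 1 = Set.univ := by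
  refine Set.eq_univ_of_forall fun y => Set.mem_iUnion.2 ⟨fun i => ⌊y i⌋, fun i => ?_⟩
  exact ⟨Int.floor_le _, (Int.lt_floor_add_one _).le⟩

/-- Only an inequality is claimed, as the closed cubes share faces; it is enough for finiteness. -/
theorem lintegral_le_tsum_box (F : EuclideanSpace ℝ (Fin m) → ℝ≥0∞) :
    ∫⁻ t, F t ≤ ∑' k : Fin m → ℤ, ∫⁻ t in box (WithLp.toLp 2 fun i => (k i : ℝ)) 1, F t := by
  rw [← setLIntegral_univ, ← iUnion_box_eq_univ]
  exact lintegral_iUnion_le _ _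

theorem MemWiener.integrable {g : EuclideanSpace ℝ (Fin m) → ℂ} (hg : MemWiener 2 g) : Integrable g := by
  refine ⟨hg.1, (lintegral_le_tsum_box _).trans_lt (lt_of_le_of_lt ?_ hg.2)⟩
  refine ENNReal.tsum_le_tsum fun k => ?_
  rw [eLpNorm_indicator_eq_eLpNorm_restrict (measurableSet_box _ _), ← eLpNorm_one_eq_lintegral_enorm]
  refine (eLpNorm_le_eLpNorm_mul_rpow_measure_univ (p := 1) (q := 2) (by norm_num)
    hg.1.restrict).trans ?_
  simp [volume_box]

/-- This is `ℓ¹ ⊆ ℓ²` for the local norms: `∑ a_k² ≤ (∑ a_k)²`. -/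
theorem MemWiener.memLp {g : EuclideanSpace ℝ (Fin m) → ℂ} (hg : MemWiener 2 g) : MemLp g 2 := by
  refine ⟨hg.1, ?_⟩
  have hsq : ∀ μ : Measure (EuclideanSpace ℝ (Fin m)), eLpNorm g 2 μ ^ 2 = ∫⁻ t, ‖g t‖ₑ ^ 2 ∂μ := fun μ => by
    have := eLpNorm_nnreal_pow_eq_lintegral (p := 2) (f := g) (μ := μ) (by norm_num)
    simpa using this
  have : eLpNorm g 2 volume ^ 2 < ∞ := by
    rw [hsq]
    refine (lintegral_le_tsum_box _).trans_lt (lt_of_le_of_lt (b := wienerNorm 2 g * wienerNorm 2 g)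
      ?_ (ENNReal.mul_lt_top hg.2 hg.2))
    conv_rhs => rw [wienerNorm, ← ENNReal.tsum_mul_right]
    refine ENNReal.tsum_le_tsum fun k => ?_
    rw [← hsq, sq, ← eLpNorm_indicator_eq_eLpNorm_restrict (measurableSet_box _ _)]
    gcongr
    exact ENNReal.le_tsum k
  exact (ENNReal.pow_lt_top_iff.1 this).resolve_right (by norm_num)

end Wiener

/-! ### Sums over translates of a lattice -/

set_option linter.unusedSectionVars false

section LatticeSums

variable {V : Type*} [NormedAddCommGroup V]

theorem one_add_norm_le_mul (v w : V) : 1 + ‖w‖ ≤ (1 + ‖v‖) * (1 + ‖v + w‖) := by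
  have h := norm_sub_le (v + w) v
  rw [add_sub_cancel_left] at h
  nlinarith [norm_nonneg v, norm_nonneg (v + w)]

variable [NormedSpace ℝ V] [FiniteDimensional ℝ V]

open Classical in
theorem summable_one_add_norm_pow_inv (L : Submodule ℤ V) [DiscreteTopology L] [IsZLattice ℝ L]
    {n : ℕ} (hn : Module.finrank ℝ V < n) : Summable fun γ : L => ((1 + ‖(γ : V)‖) ^ n)⁻¹ := by
  rw [← ZLattice.rank ℝ L] at hn
  have h1 := ZLattice.summable_norm_pow_inv L n hn
  -- The origin needs a separate summand: there `‖γ‖⁻¹` is `0` by convention, while the claimed term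
  -- is `1`.
  have h2 : Summable fun γ : L => if γ = 0 then (1 : ℝ) else 0 :=
    summable_of_hasFiniteSupport ((Set.finite_singleton (0 : L)).subset fun γ => by
      simp)
  refine Summable.of_nonneg_of_le (fun γ => by positivity) (fun γ => ?_) (h1.add h2)
  by_cases h : γ = 0
  · subst h
    simp
  · have : 0 < ‖γ‖ := norm_pos_iff.2 h
    rw [if_neg h, add_zero, inv_pow]
    gcongr
    simp

/-- Shifting the summation by a lattice vector moves `v` into a bounded fundamental domain. There
`one_add_norm_le_mul` compares the sum with the one at `v = 0`, whence a bound uniform in `v`. -/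
theorem exists_tsum_translate_le (L : Submodule ℤ V) [DiscreteTopology L] [IsZLattice ℝ L]
    {n : ℕ} (hn : Module.finrank ℝ V < n) :
    ∃ C : ℝ, 0 ≤ C ∧ ∀ (v : V) (s : Finset L), ∑ γ ∈ s, ((1 + ‖v + γ‖) ^ n)⁻¹ ≤ C := by
  have : Module.Finite ℤ L := ZLattice.module_finite ℝ L
  have : Module.Free ℤ L := ZLattice.module_free ℝ L
  let b := Module.Free.chooseBasis ℤ L
  set B := b.ofZLatticeBasis ℝ
  obtain ⟨R, hR⟩ := (ZSpan.fundamentalDomain_isBounded B).exists_norm_le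
  have hsum := summable_one_add_norm_pow_inv L hn
  have hspan : Submodule.span ℤ (Set.range B) = L := b.ofZLatticeBasis_span ℝ
  refine ⟨(1 + R) ^ n * ∑' γ : L, ((1 + ‖(γ : V)‖) ^ n)⁻¹, ?_, fun v s => ?_⟩
  · have : 0 ≤ R := (norm_nonneg _).trans (hR _ (ZSpan.fract_mem_fundamentalDomain B 0))
    have : 0 ≤ ∑' γ : L, ((1 + ‖(γ : V)‖) ^ n)⁻¹ := tsum_nonneg fun γ => by positivity
    positivity
  set w := ZSpan.fract B v
  have hw : ‖w‖ ≤ R := hR _ (ZSpan.fract_mem_fundamentalDomain B v)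
  have hfl : (ZSpan.floor B v : V) ∈ L := hspan.le (ZSpan.floor B v).2
  have hv : v = w + ZSpan.floor B v := by
    simp [w, ZSpan.fract_apply]
  let e : L ≃ L := Equiv.addLeft ⟨ZSpan.floor B v, hfl⟩
  calc ∑ γ ∈ s, ((1 + ‖v + γ‖) ^ n)⁻¹
      ≤ ∑ γ ∈ s, (1 + R) ^ n * ((1 + ‖((e γ : L) : V)‖) ^ n)⁻¹ := by
        refine Finset.sum_le_sum fun γ _ => ?_
        have he : v + γ = w + (e γ : L) := by
          simp only [e, Equiv.coe_addLeft, Submodule.coe_add, ← add_assoc, ← hv]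
        rw [he, ← div_eq_mul_inv, inv_eq_one_div, div_le_div_iff₀ (by positivity) (by positivity),
          one_mul, ← mul_pow]
        refine pow_le_pow_left₀ (by positivity) ((one_add_norm_le_mul w (e γ : L)).trans ?_) n
        gcongr
    _ = (1 + R) ^ n * ∑ γ ∈ s.map e.toEmbedding, ((1 + ‖(γ : V)‖) ^ n)⁻¹ := by
        rw [Finset.sum_map, Finset.mul_sum]
        rfl
    _ ≤ _ := by
        have : 0 ≤ R := (norm_nonneg _).trans hw
        gcongr
        exact hsum.sum_le_tsum _ fun _ _ => by positivity

end LatticeSums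

/-! ### Sampling bounds for functions with compactly supported Fourier transform -/

section Sampling

variable {V : Type*} [NormedAddCommGroup V] [InnerProductSpace ℝ V] [FiniteDimensional ℝ V]
  [MeasurableSpace V] [BorelSpace V]

/-- Convolution with such a `θ` reproduces every function with spectrum in `K`; this is how compact
support of the spectrum enters the sampling bounds. -/
theorem exists_schwartz_fourier_eq_one {K : Set V} (hK : IsCompact K) :
    ∃ θ : SchwartzMap V ℂ, ∀ t ∈ K, 𝓕 (θ : V → ℂ) t = 1 := by
  obtain ⟨r, hr0, hr⟩ := hK.isBounded.subset_closedBall_lt 0 0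
  let χ : ContDiffBump (0 : V) := ⟨r, r + 1, hr0, by linarith⟩
  have h₁ : HasCompactSupport (Complex.ofRealCLM ∘ χ) := χ.hasCompactSupport.comp_left rfl
  have h₂ : ContDiff ℝ ((⊤ : ℕ∞) : WithTop ℕ∞) (Complex.ofRealCLM ∘ χ) :=
    Complex.ofRealCLM.contDiff.comp χ.contDiff
  refine ⟨𝓕⁻ (h₁.toSchwartzMap h₂), fun t ht => ?_⟩
  rw [← SchwartzMap.fourier_coe, FourierTransform.fourier_fourierInv_eq]
  change ((χ t : ℝ) : ℂ) = 1
  rw [χ.one_of_mem_closedBall (hr ht), Complex.ofReal_one]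

theorem SchwartzMap.exists_norm_le_one_add_pow (θ : SchwartzMap V ℂ) (n : ℕ) :
    ∃ C : ℝ, 0 ≤ C ∧ ∀ w, ‖θ w‖ ≤ C * ((1 + ‖w‖) ^ n)⁻¹ := by
  refine ⟨2 ^ n * ((Finset.Iic (n, 0)).sup fun m => SchwartzMap.seminorm ℝ m.1 m.2) θ,
    by positivity, fun w => ?_⟩
  have := SchwartzMap.one_add_le_sup_seminorm_apply (𝕜 := ℝ) (m := (n, 0)) le_rfl le_rfl θ w
  rw [norm_iteratedFDeriv_zero] at this
  rw [← div_eq_mul_inv, le_div_iff₀ (by positivity), mul_comm]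
  exact this

/-- Multiplying `u` by `𝓕 θ` does not change it, so the multiplication formula yields the
reproducing formula. The sign in `z + y` reflects that `𝓕 u` is `𝓕⁻ u` evaluated at the opposite
point. -/
theorem fourierInv_eq_integral_fourier_mul {K : Set V} {u : V → ℂ} (hu : Integrable u)
    (huK : ∀ᵐ t, t ∉ K → u t = 0) {θ : SchwartzMap V ℂ} (hθ : ∀ t ∈ K, 𝓕 (θ : V → ℂ) t = 1)
    (y : V) : 𝓕⁻ u y = ∫ z, 𝓕 u z * θ (z + y) := by
  rw [integral_fourier_mul_eq hu (θ.integrable.comp_add_right y), Real.fourierInv_eq]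
  refine integral_congr_ae ?_
  filter_upwards [huK] with t ht
  rw [fourier_comp_add_right (θ : V → ℂ), real_inner_comm]
  by_cases h : t ∈ K
  · simp [hθ t h, Circle.smul_def, mul_comm]
  · simp [ht h]

theorem integrable_one_add_norm_pow_inv {n : ℕ} (hn : Module.finrank ℝ V < n) :
    Integrable fun z : V => ((1 + ‖z‖) ^ n)⁻¹ := by
  have := integrable_one_add_norm (E := V) (μ := volume) (r := n) (by exact_mod_cast hn)
  refine this.congr (Eventually.of_forall fun z => ?_)
  simp only
  rw [Real.rpow_neg (by positivity), Real.rpow_natCast]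

theorem integrable_norm_sq_mul_one_add_norm {A : V → ℂ} (hA : MemLp A 2) (n : ℕ) {W : Type*}
    [NormedAddCommGroup W] {T : V → W} (hT : Continuous T) :
    Integrable fun z => ‖A z‖ ^ 2 * ((1 + ‖T z‖) ^ n)⁻¹ := by
  have h0 : Integrable fun z => ‖A z‖ ^ 2 := hA.integrable_norm_pow (by norm_num)
  refine h0.mul_bdd (c := 1) ?_ (Eventually.of_forall fun z => ?_)
  · exact (Continuous.inv₀ (by fun_prop) fun z => by positivity).aestronglyMeasurable
  · rw [Real.norm_of_nonneg (by positivity)]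
    refine inv_le_one_of_one_le₀ (one_le_pow₀ ?_)
    linarith [norm_nonneg (T z)]

/-- A function with Fourier transform supported in `K` is controlled pointwise by weighted
`L²` averages of itself. -/
theorem exists_norm_sq_fourierInv_le {K : Set V} (hK : IsCompact K) {n : ℕ}
    (hn : Module.finrank ℝ V < n) :
    ∃ C : ℝ, 0 ≤ C ∧ ∀ u : V → ℂ, Integrable u → MemLp u 2 → (∀ᵐ t, t ∉ K → u t = 0) →
      ∀ y, ‖𝓕⁻ u y‖ ^ 2 ≤ C * ∫ z, ‖𝓕 u z‖ ^ 2 * ((1 + ‖z + y‖) ^ n)⁻¹ := by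
  obtain ⟨θ, hθ⟩ := exists_schwartz_fourier_eq_one hK
  obtain ⟨C, hC0, hC⟩ := SchwartzMap.exists_norm_le_one_add_pow θ n
  have hωi := integrable_one_add_norm_pow_inv (V := V) hn
  have hW0 : 0 ≤ ∫ z : V, ((1 + ‖z‖) ^ n)⁻¹ := integral_nonneg fun z => by positivity
  refine ⟨C ^ 2 * ∫ z : V, ((1 + ‖z‖) ^ n)⁻¹, by positivity, fun u hu1 hu2 huK y => ?_⟩
  have hA := memLp_fourier hu1 hu2
  set A := 𝓕 u
  have hA2 := integrable_norm_sq_mul_one_add_norm hA n (T := fun z => z + y) (by fun_prop)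
  set w : V → ℝ := fun z => ((1 + ‖z + y‖) ^ n)⁻¹ with hw
  have hw0 : ∀ z, 0 ≤ w z := fun z => by positivity
  have hwc : Continuous w := Continuous.inv₀ (by fun_prop) fun z => by positivity
  have hwi : Integrable w := hωi.comp_add_right y
  have hIw : ∫ z, w z = ∫ z : V, ((1 + ‖z‖) ^ n)⁻¹ :=
    integral_add_right_eq_self (fun z : V => ((1 + ‖z‖) ^ n)⁻¹) y
  have hsqw : ∀ z, Real.sqrt (w z) ^ 2 = w z := fun z => Real.sq_sqrt (hw0 z)
  have hf : MemLp (fun z => ‖A z‖ * Real.sqrt (w z)) 2 := by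
    refine (memLp_two_iff_integrable_sq (hA.1.norm.mul hwc.sqrt.aestronglyMeasurable)).2 ?_
    simpa only [Pi.mul_apply, mul_pow, hsqw] using hA2
  have hg : MemLp (fun z => Real.sqrt (w z)) 2 := by
    rw [memLp_two_iff_integrable_sq hwc.sqrt.aestronglyMeasurable]
    simpa only [hsqw] using hwi
  -- Cauchy–Schwarz for the splitting `‖A‖ w = (‖A‖ √w) · √w`.
  have hcs := integral_mul_le_Lp_mul_Lq_of_nonneg (μ := (volume : Measure V))
    Real.HolderConjugate.two_two
    (Eventually.of_forall fun z => by positivity : 0 ≤ᵐ[volume] fun z => ‖A z‖ * Real.sqrt (w z))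
    (Eventually.of_forall fun z => by positivity : 0 ≤ᵐ[volume] fun z => Real.sqrt (w z))
    (by simpa using hf) (by simpa using hg)
  simp only [Real.rpow_ofNat, mul_pow, hsqw, mul_assoc, Real.mul_self_sqrt (hw0 _)] at hcs
  rw [hIw, ← Real.sqrt_eq_rpow, ← Real.sqrt_eq_rpow] at hcs
  have hI0 : 0 ≤ ∫ z, ‖A z‖ ^ 2 * w z := integral_nonneg fun z => by have := hw0 z; positivity
  have h1 : ‖𝓕⁻ u y‖ ≤ C * ∫ z, ‖A z‖ * w z := by
    rw [fourierInv_eq_integral_fourier_mul hu1 huK hθ, ← integral_const_mul]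
    refine norm_integral_le_of_norm_le ?_ (Eventually.of_forall fun z => ?_)
    · refine Integrable.const_mul ?_ C
      have := hf.integrable_mul hg
      refine this.congr (Eventually.of_forall fun z => ?_)
      simp [mul_assoc, Real.mul_self_sqrt (hw0 z)]
    · rw [norm_mul, mul_left_comm]
      gcongr
      exact hC _
  calc ‖𝓕⁻ u y‖ ^ 2 ≤ (C * (Real.sqrt (∫ z, ‖A z‖ ^ 2 * w z)
        * Real.sqrt (∫ z : V, ((1 + ‖z‖) ^ n)⁻¹))) ^ 2 := by
        gcongr
        exact h1.trans (by gcongr)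
    _ = _ := by
        rw [mul_pow, mul_pow, Real.sq_sqrt hI0, Real.sq_sqrt hW0]
        ring

/-- **Plancherel–Pólya inequality** along a strip of a lattice in `V × ℝ`, in a form that is
uniform under bounded perturbations of the sampling points. -/
theorem exists_sampling_bound (Γ : Submodule ℤ (V × ℝ)) [DiscreteTopology Γ] [IsZLattice ℝ Γ]
    {K : Set V} (hK : IsCompact K) {R S : ℝ} (hR : 0 ≤ R) (hS : 0 ≤ S) :
    ∃ M : ℝ, 0 ≤ M ∧ ∀ u : V → ℂ, Integrable u → MemLp u 2 → (∀ᵐ t, t ∉ K → u t = 0) →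
      ∃ c : Γ → ℝ, (∀ γ, 0 ≤ c γ) ∧ Summable c ∧ ∑' γ, c γ ≤ M * ∫ t, ‖u t‖ ^ 2 ∧
        ∀ (γ : Γ) (v : V × ℝ), ‖v‖ ≤ R → |(v + γ).2| ≤ S → ‖𝓕⁻ u (v + γ).1‖ ^ 2 ≤ c γ := by
  -- The decay must beat the rank of `Γ`, which is the dimension of `V × ℝ` and not only that of
  -- `V`. In the strip, decay in the first coordinate is as good as decay in both, so the weights
  -- can be summed over the whole lattice, uniformly in `z`.
  set n := Module.finrank ℝ (V × ℝ) + 1 with hn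
  have hn1 : Module.finrank ℝ V < n := by rw [hn, Module.finrank_prod]; omega
  obtain ⟨C, hC0, hC⟩ := exists_norm_sq_fourierInv_le hK hn1
  obtain ⟨D, hD0, hD⟩ := exists_tsum_translate_le Γ (n := n) (by omega)
  refine ⟨C * (1 + R + S) ^ n * D, by positivity, fun u hu1 hu2 huK => ?_⟩
  have hA := memLp_fourier hu1 hu2
  have hA2 : ∀ γ : Γ, Integrable fun z => ‖𝓕 u z‖ ^ 2 *
      ((1 + ‖((z, 0) : V × ℝ) + γ‖) ^ n)⁻¹ := fun γ =>
    integrable_norm_sq_mul_one_add_norm hA n (T := fun z => ((z, 0) : V × ℝ) + γ) (by fun_prop)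
  set c : Γ → ℝ := fun γ => C * (1 + R + S) ^ n *
    ∫ z, ‖𝓕 u z‖ ^ 2 * ((1 + ‖((z, 0) : V × ℝ) + γ‖) ^ n)⁻¹ with hc
  have hc0 : ∀ γ, 0 ≤ c γ := fun γ =>
    mul_nonneg (by positivity) (integral_nonneg fun z => by positivity)
  have hsum : ∀ s : Finset Γ, ∑ γ ∈ s, c γ ≤ C * (1 + R + S) ^ n * D * ∫ t, ‖u t‖ ^ 2 := by
    intro s
    rw [hc, ← Finset.mul_sum, mul_assoc _ D, ← integral_norm_sq_fourier hu1 hu2]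
    gcongr
    rw [← integral_finsetSum _ fun γ _ => hA2 γ, ← integral_const_mul]
    refine integral_mono (integrable_finsetSum _ fun γ _ => hA2 γ)
      ((hA.integrable_norm_pow (by norm_num)).const_mul D) fun z => ?_
    simp only
    rw [← Finset.mul_sum, mul_comm D]
    gcongr
    exact hD (z, 0) s
  refine ⟨c, hc0, summable_of_sum_le hc0 hsum,
    (summable_of_sum_le hc0 hsum).tsum_le_of_sum_le hsum, fun γ v hv hvS => ?_⟩
  refine (hC u hu1 hu2 huK _).trans ?_
  simp only [hc, mul_assoc]
  gcongr
  rw [← integral_const_mul]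
  refine integral_mono
    (integrable_norm_sq_mul_one_add_norm hA n (T := fun z => z + (v + γ).1) (by fun_prop))
    ((hA2 γ).const_mul _) fun z => ?_
  simp only
  rw [mul_left_comm]
  gcongr
  rw [← div_eq_mul_inv, inv_eq_one_div, div_le_div_iff₀ (by positivity) (by positivity),
    one_mul, ← mul_pow]
  refine pow_le_pow_left₀ (by positivity) ?_ n
  have hv1 : ‖v.1‖ ≤ R := (norm_fst_le v).trans hv
  have hv2 : ‖v.2‖ ≤ R := (norm_snd_le v).trans hv
  have h1 : ‖z + (γ : V × ℝ).1‖ ≤ ‖z + (v + γ).1‖ + R := by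
    have := norm_sub_le (z + (v + γ).1) v.1
    have e : z + (v + γ).1 - v.1 = z + (γ : V × ℝ).1 := by
      rw [Prod.fst_add]
      abel
    rw [e] at this
    linarith
  have h2 : ‖(γ : V × ℝ).2‖ ≤ S + R := by
    have := norm_sub_le (v + γ).2 v.2
    have e : (v + γ).2 - v.2 = (γ : V × ℝ).2 := by simp
    rw [e, Real.norm_eq_abs (v + γ).2] at this
    linarith
  -- The product carries the maximum norm. With `a = ‖z + (v + γ).1‖`, this and `1 + a + R + S ≤ (1
  -- + R + S)(1 + a)` give the factor `(1 + R + S) ^ n`.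
  have h3 : ‖((z, 0) : V × ℝ) + γ‖ ≤ ‖z + (v + γ).1‖ + R + S := by
    rw [Prod.norm_def]
    refine max_le ?_ ?_
    · change ‖z + (γ : V × ℝ).1‖ ≤ _
      linarith
    · simp only [Prod.snd_add, zero_add]
      have := norm_nonneg (z + (v + γ).1)
      linarith
  nlinarith [norm_nonneg (z + (v + γ).1)]

end Sampling

/-! ### The dual lattice -/

set_option linter.unusedSectionVars false

section DualLattice

open Module

variable {m : ℕ} {ι : Type*} [Fintype ι]

/-- The Euclidean pairing of `ℝ^m × ℝ`. -/
def pairing (v w : EuclideanSpace ℝ (Fin m) × ℝ) : ℝ := inner ℝ v.1 w.1 + v.2 * w.2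

/-- The coordinates of `w` as a functional on `ℝ^m × ℝ`, with respect to the basis `B`. -/
def pairingCoords (B : Basis ι ℝ (EuclideanSpace ℝ (Fin m) × ℝ)) :
    (EuclideanSpace ℝ (Fin m) × ℝ) →ₗ[ℝ] (ι → ℝ) where
  toFun w i := pairing (B i) w
  map_add' w w' := by
    ext i
    simp only [pairing, Prod.fst_add, Prod.snd_add, inner_add_right, Pi.add_apply]
    ring
  map_smul' c w := by
    ext i
    simp only [pairing, Prod.smul_fst, Prod.smul_snd, inner_smul_right, Pi.smul_apply,
      smul_eq_mul, RingHom.id_apply]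
    ring

theorem pairing_eq_sum (B : Basis ι ℝ (EuclideanSpace ℝ (Fin m) × ℝ))
    (v w : EuclideanSpace ℝ (Fin m) × ℝ) :
    pairing v w = ∑ i, B.repr v i * pairing (B i) w := by
  conv_lhs => rw [← B.sum_repr v]
  simp only [pairing, Prod.fst_sum, Prod.snd_sum, sum_inner, Finset.sum_mul,
    ← Finset.sum_add_distrib, Prod.smul_fst, Prod.smul_snd, real_inner_smul_left, smul_eq_mul]
  refine Finset.sum_congr rfl fun i _ => ?_
  ring

theorem pairingCoords_injective (B : Basis ι ℝ (EuclideanSpace ℝ (Fin m) × ℝ)) :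
    Function.Injective (pairingCoords B) := by
  rw [injective_iff_map_eq_zero]
  intro w hw
  have h : pairing w w = 0 := by
    rw [pairing_eq_sum B]
    exact Finset.sum_eq_zero fun i _ => by rw [show pairing (B i) w = 0 from congrFun hw i, mul_zero]
  rw [pairing, real_inner_self_eq_norm_sq] at h
  have h1 : ‖w.1‖ = 0 := by nlinarith [sq_nonneg ‖w.1‖, mul_self_nonneg w.2]
  have h2 : w.2 = 0 := by nlinarith [sq_nonneg ‖w.1‖, mul_self_nonneg w.2]
  exact Prod.ext (norm_eq_zero.1 h1) h2

/-- The pairing is positive definite, so the pairings with the vectors of `B` determine `w`, and a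
dimension count makes them a coordinate system. -/
theorem exists_dual_basis (B : Basis ι ℝ (EuclideanSpace ℝ (Fin m) × ℝ)) :
    ∃ D : Basis ι ℝ (EuclideanSpace ℝ (Fin m) × ℝ), ∀ w i, D.repr w i = pairing (B i) w := by
  have hfin : finrank ℝ (EuclideanSpace ℝ (Fin m) × ℝ) = finrank ℝ (ι → ℝ) := by
    rw [finrank_eq_card_basis B, finrank_fintype_fun_eq_card]
  let T := LinearEquiv.ofInjectiveOfFinrankEq (pairingCoords B) (pairingCoords_injective B) hfin
  exact ⟨Basis.ofEquivFun T, fun w i => rfl⟩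

variable {Γ : Submodule ℤ (EuclideanSpace ℝ (Fin m) × ℝ)} [DiscreteTopology Γ] [IsZLattice ℝ Γ]

theorem dualLattice_eq_span (b : Basis ι ℤ Γ) {D : Basis ι ℝ (EuclideanSpace ℝ (Fin m) × ℝ)}
    (hD : ∀ w i, D.repr w i = pairing ((b.ofZLatticeBasis ℝ) i) w) :
    dualLattice Γ = (Submodule.span ℤ (Set.range D) : Set (EuclideanSpace ℝ (Fin m) × ℝ)) := by
  ext η
  rw [SetLike.mem_coe, Basis.mem_span_iff_repr_mem]
  simp only [hD, Set.mem_range, algebraMap_int_eq, eq_intCast]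
  constructor
  · intro h i
    obtain ⟨k, hk⟩ := h (b i) (b i).2
    exact ⟨k, by rw [Basis.ofZLatticeBasis_apply]; exact hk.symm⟩
  · intro h γ hγ
    choose k hk using h
    refine ⟨∑ i, b.repr (⟨γ, hγ⟩ : Γ) i * k i, ?_⟩
    have := pairing_eq_sum (b.ofZLatticeBasis ℝ) γ η
    rw [← pairing, this]
    push_cast
    refine Finset.sum_congr rfl fun i _ => ?_
    rw [← hk i]
    congr 1
    exact b.ofZLatticeBasis_repr_apply ℝ Γ ⟨γ, hγ⟩ i

/-- The dual lattice is parametrized by `ℤ^ι`, compatibly with the coordinates of a basis. -/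
theorem exists_equiv_dualLattice (b : Basis ι ℤ Γ) :
    ∃ e : (ι → ℤ) ≃ dualLattice Γ, ∀ n v,
      ∑ i, n i * (b.ofZLatticeBasis ℝ).repr v i = pairing v (e n) := by
  obtain ⟨D, hD⟩ := exists_dual_basis (b.ofZLatticeBasis ℝ)
  have h := dualLattice_eq_span b hD
  refine ⟨(D.restrictScalars ℤ).equivFun.symm.toEquiv.trans (Equiv.setCongr h.symm), fun n v => ?_⟩
  rw [pairing_eq_sum (b.ofZLatticeBasis ℝ)]
  refine Finset.sum_congr rfl fun i _ => ?_
  rw [← hD, mul_comm]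
  congr 1
  have h1 := (D.restrictScalars_repr_apply ℤ ((D.restrictScalars ℤ).equivFun.symm n) i)
  rw [← Basis.equivFun_apply, LinearEquiv.apply_symm_apply] at h1
  exact h1

theorem summable_dualLattice {n : ℕ} (hn : m + 1 < n) :
    Summable fun η : dualLattice Γ => ((1 + ‖(η : EuclideanSpace ℝ (Fin m) × ℝ)‖) ^ n)⁻¹ := by
  have : Module.Finite ℤ Γ := ZLattice.module_finite ℝ Γ
  have : Module.Free ℤ Γ := ZLattice.module_free ℝ Γ
  let b := Free.chooseBasis ℤ Γ
  obtain ⟨D, hD⟩ := exists_dual_basis (b.ofZLatticeBasis ℝ)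
  have h := dualLattice_eq_span b hD
  have hs := summable_one_add_norm_pow_inv (Submodule.span ℤ (Set.range D)) (n := n)
    (by simpa [finrank_prod] using hn)
  exact (Equiv.setCongr h).summable_iff.2 hs

instance : Countable (dualLattice Γ) := by
  have : Module.Finite ℤ Γ := ZLattice.module_finite ℝ Γ
  have : Module.Free ℤ Γ := ZLattice.module_free ℝ Γ
  obtain ⟨e, -⟩ := exists_equiv_dualLattice (Free.chooseBasis ℤ Γ)
  exact e.symm.injective.countable

/-- If two dual points differ only by `d ≠ 0` in the second coordinate, then `p₂(γ) d` is an integer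
for every `γ ∈ Γ`, which contradicts the density of `p₂(Γ)`. -/
theorem dualLattice_fst_injective (hΓ : IsCutAndProject Γ) :
    Function.Injective fun η : dualLattice Γ => (η : EuclideanSpace ℝ (Fin m) × ℝ).1 := by
  intro η η' h
  refine Subtype.ext (Prod.ext h ?_)
  by_contra hne
  set d := (η : EuclideanSpace ℝ (Fin m) × ℝ).2 - (η' : EuclideanSpace ℝ (Fin m) × ℝ).2
  have hd : 0 < |d| := abs_pos.2 (sub_ne_zero.2 hne)
  -- Aiming at `1/(2d)` with error below `1/(4|d|)` puts `p₂(γ) d` strictly between `1/4` and `3/4`.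
  obtain ⟨_, ⟨γ, hγ, rfl⟩, hlt⟩ :=
    hΓ.dense_snd.exists_dist_lt (2 * d)⁻¹ (ε := (4 * |d|)⁻¹) (by positivity)
  obtain ⟨k, hk⟩ := η.2 γ hγ
  obtain ⟨k', hk'⟩ := η'.2 γ hγ
  simp only at h
  have e1 : γ.2 * d = ((k - k' : ℤ) : ℝ) := by
    push_cast
    rw [← hk, ← hk', h]
    ring
  have e2 : |2⁻¹ - γ.2 * d| < 4⁻¹ := by
    rw [Real.dist_eq] at hlt
    have hd0 : d ≠ 0 := abs_pos.1 hd
    have : 2⁻¹ - γ.2 * d = ((2 * d)⁻¹ - γ.2) * d := by field_simp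
    rw [this, abs_mul]
    calc _ < (4 * |d|)⁻¹ * |d| := by gcongr
      _ = 4⁻¹ := by field_simp
  rw [e1, abs_lt] at e2
  have h1 : (0 : ℝ) < ((k - k' : ℤ) : ℝ) := by linarith [e2.2]
  have h2 : ((k - k' : ℤ) : ℝ) < 1 := by linarith [e2.1]
  have h3 : 0 < k - k' := by exact_mod_cast h1
  have h4 : k - k' < 1 := by exact_mod_cast h2
  omega

end DualLattice

/-! ### Smooth weights -/

section Weights

variable {m : ℕ} {ψ : ℝ → ℝ} {Ω : Set ℝ}

/-- The square of a weight function, with values in `ℂ`. -/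
def sqWeight (ψ : ℝ → ℝ) (s : ℝ) : ℂ := ((ψ s ^ 2 : ℝ) : ℂ)

theorem IsSmoothSupportedIn.continuous (hψ : IsSmoothSupportedIn ψ Ω) : Continuous (sqWeight ψ) :=
  Complex.continuous_ofReal.comp (hψ.contDiff.continuous.pow 2)

theorem IsSmoothSupportedIn.hasCompactSupport (hψ : IsSmoothSupportedIn ψ Ω) (hΩ : IsCompact Ω) :
    HasCompactSupport (sqWeight ψ) := by
  have h : HasCompactSupport ψ := hΩ.of_isClosed_subset (isClosed_tsupport ψ) hψ.tsupport_subset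
  exact h.comp_left (g := fun x : ℝ => ((x ^ 2 : ℝ) : ℂ)) (by simp)

theorem IsSmoothSupportedIn.eq_zero (hψ : IsSmoothSupportedIn ψ Ω) {s : ℝ} (hs : s ∉ Ω) :
    ψ s = 0 :=
  image_eq_zero_of_notMem_tsupport fun h => hs (hψ.tsupport_subset h)

theorem IsSmoothSupportedIn.exists_norm_fourier_le (hψ : IsSmoothSupportedIn ψ Ω)
    (hΩ : IsCompact Ω) (n : ℕ) :
    ∃ C : ℝ, 0 ≤ C ∧ ∀ σ, ‖𝓕 (sqWeight ψ) σ‖ ≤ C * ((1 + ‖σ‖) ^ n)⁻¹ := by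
  have h₂ : ContDiff ℝ ((⊤ : ℕ∞) : WithTop ℕ∞) (sqWeight ψ) :=
    Complex.ofRealCLM.contDiff.comp (hψ.contDiff.pow 2)
  exact SchwartzMap.exists_norm_le_one_add_pow (𝓕 ((hψ.hasCompactSupport hΩ).toSchwartzMap h₂)) n

/-- In the slab `‖η.1‖ ≤ R` the size of `η` is comparable to that of `η.2`, so rapid decay in `η.2`
suffices. The exponent `m + 2` exceeds the rank `m + 1`. -/
theorem IsSmoothSupportedIn.summable_dualLattice (hψ : IsSmoothSupportedIn ψ Ω)
    (hΩ : IsCompact Ω) (Γ : Submodule ℤ (EuclideanSpace ℝ (Fin m) × ℝ)) [DiscreteTopology Γ]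
    [IsZLattice ℝ Γ] {R : ℝ} (hR : 0 ≤ R) :
    Summable fun η : dualLattice Γ => {η : EuclideanSpace ℝ (Fin m) × ℝ | ‖η.1‖ ≤ R}.indicator
      (fun η => ‖𝓕 (sqWeight ψ) η.2‖) η := by
  obtain ⟨C, hC0, hC⟩ := hψ.exists_norm_fourier_le hΩ (m + 2)
  refine Summable.of_nonneg_of_le (fun η => Set.indicator_nonneg (fun _ _ => norm_nonneg _) _)
    (fun η => ?_) ((ModelSetFrames.summable_dualLattice (Γ := Γ) (n := m + 2) (by omega)).mul_left
      (C * (1 + R) ^ (m + 2)))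
  obtain ⟨η, -⟩ := η
  by_cases hη : ‖η.1‖ ≤ R
  swap
  · rw [Set.indicator_of_notMem (by exact hη)]
    positivity
  rw [Set.indicator_of_mem (by exact hη)]
  refine (hC _).trans ?_
  rw [mul_assoc]
  gcongr
  rw [← div_eq_mul_inv, inv_eq_one_div, div_le_div_iff₀ (by positivity) (by positivity),
    one_mul, ← mul_pow]
  refine pow_le_pow_left₀ (by positivity) ?_ _
  have : ‖η‖ ≤ R + ‖η.2‖ := by
    rw [Prod.norm_def]
    exact max_le (by linarith [norm_nonneg η.2]) (by linarith)
  nlinarith [norm_nonneg η.2]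

end Weights

/-! ### Mean values of absolutely convergent trigonometric series -/

section Means

variable {m : ℕ}

theorem norm_character (ω t : EuclideanSpace ℝ (Fin m)) : ‖character ω t‖ = 1 := by
  rw [character, show 2 * (Real.pi : ℂ) * Complex.I * ((inner ℝ ω t : ℝ) : ℂ)
    = ((2 * Real.pi * inner ℝ ω t : ℝ) : ℂ) * Complex.I by push_cast; ring]
  exact Complex.norm_exp_ofReal_mul_I _

theorem continuous_character (ω : EuclideanSpace ℝ (Fin m)) : Continuous (character ω) := by
  unfold character
  fun_prop

theorem character_add_left (ω ω' t : EuclideanSpace ℝ (Fin m)) :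
    character (ω + ω') t = character ω t * character ω' t := by
  rw [character, character, character, ← Complex.exp_add, inner_add_left]
  push_cast
  ring_nf

theorem character_add_right (ω t t' : EuclideanSpace ℝ (Fin m)) :
    character ω (t + t') = character ω t * character ω t' := by
  rw [character, character, character, ← Complex.exp_add, inner_add_right]
  push_cast
  ring_nf

theorem tendsto_mean_exp (w a : ℝ) :
    Tendsto (fun R : ℝ => (R : ℂ)⁻¹ *
      ∫ s in Set.Icc a (a + R), Complex.exp (2 * Real.pi * Complex.I * ((w * s : ℝ) : ℂ)))
      atTop (𝓝 (if w = 0 then 1 else 0)) := by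
  split_ifs with hw
  · refine tendsto_const_nhds.congr' ?_
    filter_upwards [eventually_gt_atTop 0] with R hR
    have : (R : ℂ) ≠ 0 := by exact_mod_cast hR.ne'
    simp [hw, Measure.real, ENNReal.toReal_ofReal hR.le, this]
  · set c : ℂ := 2 * Real.pi * Complex.I * w with hc
    have hc0 : c ≠ 0 := by
      have : (Real.pi : ℂ) ≠ 0 := by exact_mod_cast Real.pi_ne_zero
      have : (w : ℂ) ≠ 0 := by exact_mod_cast hw
      simp [*]
    rw [tendsto_zero_iff_norm_tendsto_zero]
    -- The antiderivative `e^{cs}/c` is bounded, so the integral is at most `2/‖c‖` for every `R`.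
    refine squeeze_zero' (g := fun R : ℝ => R⁻¹ * (2 / ‖c‖)) (Eventually.of_forall fun _ => norm_nonneg _) ?_ ?_
    · filter_upwards [eventually_gt_atTop 0] with R hR
      have h1 : ∀ s : ℝ, 2 * (Real.pi : ℂ) * Complex.I * ((w * s : ℝ) : ℂ) = c * s := fun s => by
        rw [hc]; push_cast; ring
      have h2 : ∀ s : ℝ, ‖Complex.exp (c * s)‖ = 1 := fun s => by
        rw [hc, show 2 * (Real.pi : ℂ) * Complex.I * w * s
          = ((2 * Real.pi * w * s : ℝ) : ℂ) * Complex.I by push_cast; ring]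
        exact Complex.norm_exp_ofReal_mul_I _
      simp only [h1]
      rw [integral_Icc_eq_integral_Ioc, ← intervalIntegral.integral_of_le (by linarith),
        integral_exp_mul_complex hc0, norm_mul, norm_inv, Complex.norm_real, norm_div,
        Real.norm_of_nonneg hR.le]
      gcongr
      exact (norm_sub_le _ _).trans (by rw [h2, h2]; norm_num)
    · simpa using tendsto_inv_atTop_zero.mul_const (2 / ‖c‖)

theorem setIntegral_box_prod (F : Fin m → ℝ → ℂ) (x : EuclideanSpace ℝ (Fin m)) (R : ℝ) :
    ∫ t in box x R, ∏ i, F i (t i) = ∏ i, ∫ s in Set.Icc (x i) (x i + R), F i s := by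
  rw [box_eq_preimage]
  have h := (EuclideanSpace.volume_preserving_symm_measurableEquiv_toLp
    (Fin m)).setIntegral_preimage_emb (MeasurableEquiv.measurableEmbedding _)
    (fun y : Fin m → ℝ => ∏ i, F i (y i)) (Set.pi Set.univ fun i => Set.Icc (x i) (x i + R))
  refine h.trans ?_
  rw [volume_pi, Measure.restrict_pi_pi, integral_fintype_prod_eq_prod]

theorem hasMean_character (ω : EuclideanSpace ℝ (Fin m)) :
    HasMean (character ω) (if ω = 0 then 1 else 0) := by
  intro x
  have h := tendsto_finsetProd (Finset.univ : Finset (Fin m))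
    fun i _ => tendsto_mean_exp (ω i) (x i)
  have e1 : (∏ i, if ω i = 0 then (1 : ℂ) else 0) = if ω = 0 then 1 else 0 := by
    split_ifs with h0
    · simp [h0]
    · obtain ⟨i, hi⟩ : ∃ i, ω i ≠ 0 := by
        by_contra! hcon
        exact h0 (by ext i; exact hcon i)
      exact Finset.prod_eq_zero (Finset.mem_univ i) (if_neg hi)
  rw [e1] at h
  refine h.congr fun R => ?_
  rw [Finset.prod_mul_distrib, Finset.prod_const, Finset.card_univ, Fintype.card_fin, inv_pow,
    ← setIntegral_box_prod]
  congr 1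
  refine integral_congr_ae (Eventually.of_forall fun t => ?_)
  simp only [character, ← Complex.exp_sum, ← Finset.mul_sum, PiLp.inner_apply]
  simp [mul_comm]

theorem norm_mean_le {F : EuclideanSpace ℝ (Fin m) → ℂ} {C : ℝ} (hF : ∀ t, ‖F t‖ ≤ C)
    (x : EuclideanSpace ℝ (Fin m)) {R : ℝ} (hR : 0 < R) :
    ‖((R : ℂ) ^ m)⁻¹ * ∫ t in box x R, F t‖ ≤ C := by
  have hv : volume.real (box x R) = R ^ m := by
    rw [Measure.real, volume_box, ENNReal.toReal_pow, ENNReal.toReal_ofReal hR.le]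
  have h := norm_setIntegral_le_of_norm_le_const (μ := volume) (s := box x R)
    (by rw [volume_box]; exact ENNReal.pow_lt_top ENNReal.ofReal_lt_top) fun t _ => hF t
  rw [norm_mul, norm_inv, norm_pow, Complex.norm_real, Real.norm_of_nonneg hR.le]
  rw [hv] at h
  calc _ ≤ (R ^ m)⁻¹ * (C * R ^ m) := by gcongr
    _ = C := by field_simp

/-- Averages of a character have modulus at most `1`, so `‖a i‖` dominates and the limit in `R`
passes through the sum. -/
theorem hasMean_tsum {I : Type*} [Countable I] {a : I → ℂ} (ha : Summable fun i => ‖a i‖)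
    (ν : I → EuclideanSpace ℝ (Fin m)) :
    HasMean (fun t => ∑' i, a i * character (ν i) t) (∑' i, a i * if ν i = 0 then 1 else 0) := by
  intro x
  have hint : ∀ R : ℝ, ((R : ℂ) ^ m)⁻¹ * ∫ t in box x R, ∑' i, a i * character (ν i) t
      = ∑' i, ((R : ℂ) ^ m)⁻¹ * ∫ t in box x R, a i * character (ν i) t := by
    intro R
    have hfin : volume (box x R) ≠ ∞ := by
      rw [volume_box]; exact (ENNReal.pow_lt_top ENNReal.ofReal_lt_top).ne
    have : IsFiniteMeasure (volume.restrict (box x R)) := isFiniteMeasure_restrict.2 hfin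
    rw [← tsum_mul_left.symm, integral_tsum_of_summable_integral_norm]
    · intro i
      refine Integrable.const_mul ?_ _
      exact Integrable.of_bound (continuous_character _).aestronglyMeasurable 1
        (Eventually.of_forall fun t => (norm_character _ _).le)
    · simp only [norm_mul, norm_character, mul_one, integral_const, smul_eq_mul]
      exact ha.mul_left _
  simp only [hint]
  refine tendsto_tsum_of_dominated_convergence ha (fun i => ?_) ?_
  · have := (hasMean_character (ν i) x).const_mul (a i)
    refine this.congr fun R => ?_
    rw [integral_const_mul]
    ring
  · filter_upwards [eventually_gt_atTop 0] with R hR i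
    exact norm_mean_le (fun t => by rw [norm_mul, norm_character, mul_one]) x hR

theorem hasFourierCoeff_tsum {I : Type*} [Countable I] {a : I → ℂ} (ha : Summable fun i => ‖a i‖)
    (ν : I → EuclideanSpace ℝ (Fin m)) (ω : EuclideanSpace ℝ (Fin m)) :
    HasFourierCoeff (fun t => ∑' i, a i * character (-ν i) t) ω
      (∑' i, a i * if ν i = ω then 1 else 0) := by
  have h := hasMean_tsum ha fun i => -ν i + ω
  simp only [neg_add_eq_zero] at h
  refine fun x => (h x).congr fun R => ?_
  simp only [character_add_left, ← mul_assoc, tsum_mul_right]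

end Means

/-! ### Almost periods -/

set_option linter.unusedSectionVars false

section AlmostPeriods

variable {m : ℕ} {Γ : Submodule ℤ (EuclideanSpace ℝ (Fin m) × ℝ)} [DiscreteTopology Γ]
  [IsZLattice ℝ Γ]

/-- Model sets with a window containing a neighborhood of the origin are relatively dense. -/
theorem relativelyDense_strip (hΓ : IsCutAndProject Γ) {δ : ℝ} (hδ : 0 < δ) :
    RelativelyDense {τ : EuclideanSpace ℝ (Fin m) | ∃ γ ∈ Γ, |γ.2| < δ ∧ γ.1 = τ} := by
  have : Module.Finite ℤ Γ := ZLattice.module_finite ℝ Γ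
  have : Module.Free ℤ Γ := ZLattice.module_free ℝ Γ
  let b := Module.Free.chooseBasis ℤ Γ
  set B := b.ofZLatticeBasis ℝ
  have hspan : Submodule.span ℤ (Set.range B) = Γ := b.ofZLatticeBasis_span ℝ
  obtain ⟨R, hR⟩ := (ZSpan.fundamentalDomain_isBounded B).exists_norm_le
  have hR0 : 0 ≤ R := (norm_nonneg _).trans (hR _ (ZSpan.fract_mem_fundamentalDomain B 0))
  -- Rounding a point of `ℝ^m × {0}` to `Γ` leaves a second coordinate in `[-R, R]`. By density and
  -- compactness, subtracting one of finitely many lattice points makes it smaller than `δ`; this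
  -- moves the first coordinate by at most `M`.
  obtain ⟨s, hs⟩ := (isCompact_Icc (a := -R) (b := R)).elim_finite_subcover
    (fun γ : Γ => Metric.ball (γ : EuclideanSpace ℝ (Fin m) × ℝ).2 δ) (fun _ => Metric.isOpen_ball)
    fun σ _ => by
      obtain ⟨_, ⟨γ, hγ, rfl⟩, h⟩ := hΓ.dense_snd.exists_dist_lt σ hδ
      exact Set.mem_iUnion.2 ⟨⟨γ, hγ⟩, h⟩
  set M := ∑ γ ∈ s, ‖(γ : EuclideanSpace ℝ (Fin m) × ℝ)‖
  have hM0 : 0 ≤ M := Finset.sum_nonneg fun _ _ => norm_nonneg _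
  refine ⟨2 * (R + M) + 1, by positivity, fun t => ?_⟩
  -- Each coordinate of `z` lies `R + M` above that of `t`, so a total displacement of at most `R +
  -- M` stays in the cube; the extra `1` in the side keeps it positive.
  set z : EuclideanSpace ℝ (Fin m) := WithLp.toLp 2 fun i => t i + (R + M)
  set γ : EuclideanSpace ℝ (Fin m) × ℝ := Subtype.val (ZSpan.floor B (z, 0))
  have hγ : γ ∈ Γ := hspan.le (ZSpan.floor B (z, 0)).2
  have hfr : ‖(z, (0 : ℝ)) - γ‖ ≤ R := hR _ (ZSpan.fract_mem_fundamentalDomain B (z, 0))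
  have h1 : ‖z - γ.1‖ ≤ R := (norm_fst_le ((z, (0 : ℝ)) - γ)).trans hfr
  have h2 : |γ.2| ≤ R := by
    have := (norm_snd_le ((z, (0 : ℝ)) - γ)).trans hfr
    simpa using this
  obtain ⟨γ', hγ's, hγ'⟩ : ∃ γ' ∈ s, |γ.2 - (γ' : EuclideanSpace ℝ (Fin m) × ℝ).2| < δ := by
    have := hs (abs_le.1 h2)
    simpa [Real.dist_eq] using this
  refine ⟨γ.1 - (γ' : EuclideanSpace ℝ (Fin m) × ℝ).1,
    ⟨γ - γ', sub_mem hγ γ'.2, hγ', rfl⟩, fun i => ?_⟩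
  have h3 : ‖(γ' : EuclideanSpace ℝ (Fin m) × ℝ).1‖ ≤ M := (norm_fst_le _).trans
    (Finset.single_le_sum (f := fun γ : Γ => ‖(γ : EuclideanSpace ℝ (Fin m) × ℝ)‖)
      (fun _ _ => norm_nonneg _) hγ's)
  have h4 := (PiLp.norm_apply_le (z - γ.1) i).trans h1
  have h5 := (PiLp.norm_apply_le (γ' : EuclideanSpace ℝ (Fin m) × ℝ).1 i).trans h3
  have h6 : (z - γ.1) i = t i + (R + M) - γ.1 i := rfl
  rw [h6, Real.norm_eq_abs, abs_le] at h4
  rw [Real.norm_eq_abs, abs_le] at h5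
  have h7 : (γ.1 - (γ' : EuclideanSpace ℝ (Fin m) × ℝ).1) i
    = γ.1 i - (γ' : EuclideanSpace ℝ (Fin m) × ℝ).1 i := rfl
  rw [h7]
  constructor <;> linarith

/-- Integrality of `γ · η` trades the physical phase for an internal one, which is close to `1` when
`γ.2` is small. -/
theorem character_neg_dual {γ η : EuclideanSpace ℝ (Fin m) × ℝ} (hγ : γ ∈ Γ)
    (hη : η ∈ dualLattice Γ) :
    character (-η.1) γ.1 = Complex.exp (2 * Real.pi * Complex.I * ((η.2 * γ.2 : ℝ) : ℂ)) := by
  obtain ⟨k, hk⟩ := hη γ hγ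
  rw [character, Complex.exp_eq_exp_iff_exists_int]
  refine ⟨-k, ?_⟩
  have : inner ℝ (-η.1) γ.1 = η.2 * γ.2 - k := by
    rw [inner_neg_left, real_inner_comm, ← hk]
    ring
  rw [this]
  push_cast
  ring

theorem almostPeriodic_tsum (hΓ : IsCutAndProject Γ) {a : dualLattice Γ → ℂ}
    (ha : Summable fun η => ‖a η‖) :
    AlmostPeriodic fun x => ∑' η : dualLattice Γ,
      a η * character (-(η : EuclideanSpace ℝ (Fin m) × ℝ).1) x := by
  have hterm : ∀ (η : dualLattice Γ) (x : EuclideanSpace ℝ (Fin m)),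
      ‖a η * character (-(η : EuclideanSpace ℝ (Fin m) × ℝ).1) x‖ ≤ ‖a η‖ := fun η x => by
    rw [norm_mul, norm_character, mul_one]
  have hsum : ∀ x : EuclideanSpace ℝ (Fin m), Summable fun η : dualLattice Γ =>
      a η * character (-(η : EuclideanSpace ℝ (Fin m) × ℝ).1) x := fun x =>
    Summable.of_norm_bounded ha fun η => hterm η x
  refine ⟨continuous_tsum (fun η => continuous_const.mul (continuous_character _)) ha hterm,
    ⟨∑' η, ‖a η‖, fun x => tsum_of_norm_bounded ha.hasSum fun η => hterm η x⟩, fun ε hε => ?_⟩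
  set e : dualLattice Γ → ℝ → ℂ := fun η σ => Complex.exp
    (2 * Real.pi * Complex.I * (((η : EuclideanSpace ℝ (Fin m) × ℝ).2 * σ : ℝ) : ℂ)) with he
  have he1 : ∀ η σ, ‖e η σ‖ = 1 := fun η σ => by
    rw [he]
    simp only
    rw [show ∀ r : ℝ, 2 * (Real.pi : ℂ) * Complex.I * (r : ℂ)
      = ((2 * Real.pi * r : ℝ) : ℂ) * Complex.I from fun r => by push_cast; ring]
    exact Complex.norm_exp_ofReal_mul_I _
  have hbd : ∀ η σ, ‖a η‖ * ‖e η σ - 1‖ ≤ ‖a η‖ * 2 := fun η σ => by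
    gcongr
    exact (norm_sub_le _ _).trans (by rw [he1, norm_one]; norm_num)
  -- This function of `σ = p₂(γ)` bounds the change under translation by `p₁(γ)`. It is continuous
  -- and vanishes at `0`, so a strip of small width consists of `ε`-almost periods.
  have hG : Continuous fun σ => ∑' η, ‖a η‖ * ‖e η σ - 1‖ := by
    refine continuous_tsum (fun η => ?_) (ha.mul_right 2) fun η σ => ?_
    · simp only [he]
      fun_prop
    · rw [Real.norm_of_nonneg (by positivity)]
      exact hbd η σ
  have hG0 : ∑' η, ‖a η‖ * ‖e η 0 - 1‖ = 0 := by simp [he]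
  obtain ⟨δ, hδ, hδε⟩ := Metric.continuous_iff.1 hG 0 ε hε
  refine ⟨_, relativelyDense_strip hΓ hδ, ?_⟩
  rintro _ ⟨γ, hγ, hγδ, rfl⟩ t
  rw [← (hsum _).tsum_sub (hsum _)]
  have hlt := hδε γ.2 (by simpa [Real.dist_eq] using hγδ)
  rw [hG0, Real.dist_eq, sub_zero] at hlt
  refine (tsum_of_norm_bounded (Summable.hasSum ?_) fun η => ?_).trans
    ((le_abs_self _).trans hlt.le)
  · exact Summable.of_nonneg_of_le (fun η => by positivity) (fun η => hbd η γ.2) (ha.mul_right 2)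
  · rw [character_add_right, character_neg_dual hγ η.2, ← mul_assoc,
      show ∀ p q : ℂ, p * q - p = p * (q - 1) from fun p q => by ring, norm_mul]
    gcongr
    exact hterm η t

end AlmostPeriods

/-! ### Poisson summation for products of band-limited functions -/

section BandLimited

variable {m : ℕ}

/-- An integrable and square integrable function that vanishes almost everywhere off `S`. -/
structure IsSpectrumIn (S : Set (EuclideanSpace ℝ (Fin m)))
    (u : EuclideanSpace ℝ (Fin m) → ℂ) : Prop where
  integrable : Integrable u
  memLp : MemLp u 2
  ae_eq_zero : ∀ᵐ t, t ∉ S → u t = 0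

variable {S : Set (EuclideanSpace ℝ (Fin m))} {u v : EuclideanSpace ℝ (Fin m) → ℂ}

/-- The correlation `∫ u(t) conj(v(t - ω)) dt`. -/
def correlation (u v : EuclideanSpace ℝ (Fin m) → ℂ) (ω : EuclideanSpace ℝ (Fin m)) : ℂ :=
  ∫ t, u t * conj (v (t - ω))

theorem IsSpectrumIn.memLp_translate (hv : IsSpectrumIn S v) (ω : EuclideanSpace ℝ (Fin m)) :
    MemLp (fun t => conj (v (t - ω))) 2 :=
  (hv.memLp.comp_measurePreserving (measurePreserving_sub_right volume ω)).star

theorem IsSpectrumIn.integrable_mul_conj (hu : IsSpectrumIn S u) (hv : IsSpectrumIn S v)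
    (ω : EuclideanSpace ℝ (Fin m)) : Integrable fun t => u t * conj (v (t - ω)) :=
  hu.memLp.integrable_mul (hv.memLp_translate ω)

theorem IsSpectrumIn.integrable_sq (hu : IsSpectrumIn S u) : Integrable fun t => ‖u t‖ ^ 2 :=
  hu.memLp.integrable_norm_pow (by norm_num)

theorem IsSpectrumIn.integral_norm_le (hu : IsSpectrumIn S u) (hv : IsSpectrumIn S v)
    (ω : EuclideanSpace ℝ (Fin m)) :
    ∫ t, ‖u t * conj (v (t - ω))‖ ≤ (∫ t, ‖u t‖ ^ 2) + ∫ t, ‖v t‖ ^ 2 := by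
  have h2 : Integrable fun t => ‖v (t - ω)‖ ^ 2 := hv.integrable_sq.comp_sub_right ω
  rw [← integral_sub_right_eq_self (fun t => ‖v t‖ ^ 2) ω, ← integral_add hu.integrable_sq h2]
  refine integral_mono (hu.integrable_mul_conj hv ω).norm (hu.integrable_sq.add h2) fun t => ?_
  simp only [norm_mul, RCLike.norm_conj]
  nlinarith [sq_nonneg (‖u t‖ - ‖v (t - ω)‖), sq_nonneg ‖u t‖, sq_nonneg ‖v (t - ω)‖]

theorem IsSpectrumIn.norm_correlation_le (hu : IsSpectrumIn S u) (hv : IsSpectrumIn S v)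
    (ω : EuclideanSpace ℝ (Fin m)) :
    ‖correlation u v ω‖ ≤ (∫ t, ‖u t‖ ^ 2) + ∫ t, ‖v t‖ ^ 2 :=
  (norm_integral_le_integral_norm _).trans (hu.integral_norm_le hv ω)

/-- For `‖ω‖ > 2r` the set `S` and its translate by `ω` are disjoint. -/
theorem IsSpectrumIn.correlation_eq_zero (hu : IsSpectrumIn S u) (hv : IsSpectrumIn S v)
    {r : ℝ} (hr : ∀ t ∈ S, ‖t‖ ≤ r) {ω : EuclideanSpace ℝ (Fin m)} (hω : ¬ ‖ω‖ ≤ 2 * r) :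
    correlation u v ω = 0 := by
  refine integral_eq_zero_of_ae ?_
  have h2 : ∀ᵐ t, t - ω ∉ S → v (t - ω) = 0 :=
    (measurePreserving_sub_right volume ω).quasiMeasurePreserving.ae hv.ae_eq_zero
  filter_upwards [hu.ae_eq_zero, h2] with t h1 h2
  by_cases ht : t ∈ S
  · have : t - ω ∉ S := fun h => hω (by
      have := norm_sub_le t (t - ω)
      rw [sub_sub_cancel] at this
      linarith [hr t ht, hr _ h])
    simp [h2 this]
  · simp [h1 ht]

/-- The product of `𝓕⁻¹ u · conj(𝓕⁻¹ v)` with a weight in the internal space. -/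
def bandProduct (u v : EuclideanSpace ℝ (Fin m) → ℂ) (ψ : ℝ → ℝ)
    (w : EuclideanSpace ℝ (Fin m) × ℝ) : ℂ :=
  𝓕⁻ u w.1 * conj (𝓕⁻ v w.1) * sqWeight ψ w.2

theorem IsSpectrumIn.continuous_fourierInv (hu : IsSpectrumIn S u) : Continuous (𝓕⁻ u) := by
  have : 𝓕⁻ u = fun y => 𝓕 u (-y) := funext fun y => Real.fourierInv_eq_fourier_neg u y
  rw [this]
  exact (continuous_fourier hu.integrable).comp continuous_neg

variable {ψ : ℝ → ℝ} {Ω : Set ℝ}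

theorem continuous_bandProduct (hu : IsSpectrumIn S u) (hv : IsSpectrumIn S v)
    (hψ : IsSmoothSupportedIn ψ Ω) : Continuous (bandProduct u v ψ) := by
  have h1 := hu.continuous_fourierInv
  have h2 := hv.continuous_fourierInv
  have h3 := hψ.continuous
  have h4 : Continuous (conj : ℂ → ℂ) := Complex.continuous_conj
  unfold bandProduct
  fun_prop

variable {Γ : Submodule ℤ (EuclideanSpace ℝ (Fin m) × ℝ)} [DiscreteTopology Γ] [IsZLattice ℝ Γ]

theorem exists_bandProduct_bound (Γ : Submodule ℤ (EuclideanSpace ℝ (Fin m) × ℝ))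
    [DiscreteTopology Γ] [IsZLattice ℝ Γ] (hS : IsCompact S) (hΩ : IsCompact Ω)
    (hψ : IsSmoothSupportedIn ψ Ω) {R : ℝ} (hR : 0 ≤ R) :
    ∃ M : ℝ, 0 ≤ M ∧ ∀ u v, IsSpectrumIn S u → IsSpectrumIn S v →
      ∃ c : Γ → ℝ, Summable c ∧ ∑' γ, c γ ≤ M * ((∫ t, ‖u t‖ ^ 2) + ∫ t, ‖v t‖ ^ 2) ∧
        ∀ (γ : Γ) (w : EuclideanSpace ℝ (Fin m) × ℝ), ‖w‖ ≤ R →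
          ‖bandProduct u v ψ (w + γ)‖ ≤ c γ := by
  obtain ⟨s, hs0, hs⟩ := hΩ.isBounded.subset_closedBall_lt 0 0
  obtain ⟨P, hP⟩ := hψ.continuous.bounded_above_of_compact_support (hψ.hasCompactSupport hΩ)
  have hP0 : 0 ≤ P := (norm_nonneg _).trans (hP 0)
  obtain ⟨M, hM0, hM⟩ := exists_sampling_bound Γ hS hR hs0.le
  refine ⟨M * P, by positivity, fun u v hu hv => ?_⟩
  obtain ⟨cu, hcu0, hcus, hcuM, hcu⟩ := hM u hu.integrable hu.memLp hu.ae_eq_zero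
  obtain ⟨cv, hcv0, hcvs, hcvM, hcv⟩ := hM v hv.integrable hv.memLp hv.ae_eq_zero
  refine ⟨fun γ => (cu γ + cv γ) * P, (hcus.add hcvs).mul_right P, ?_, fun γ w hw => ?_⟩
  · rw [tsum_mul_right, hcus.tsum_add hcvs]
    nlinarith
  -- Inside the strip the sampling bound applies to both factors; outside it the weight is zero.
  · by_cases hsup : |(w + γ).2| ≤ s
    · have h1 := hcu γ w hw hsup
      have h2 := hcv γ w hw hsup
      rw [bandProduct, norm_mul, norm_mul, RCLike.norm_conj]
      refine mul_le_mul ?_ (hP _) (norm_nonneg _) (add_nonneg (hcu0 γ) (hcv0 γ))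
      have := hcu0 γ
      have := hcv0 γ
      nlinarith [sq_nonneg (‖𝓕⁻ u (w + γ).1‖ - ‖𝓕⁻ v (w + γ).1‖)]
    · have h0 : (w + (γ : EuclideanSpace ℝ (Fin m) × ℝ)).2 ∉ Ω := fun h => hsup (by
        simpa [Real.norm_eq_abs] using hs h)
      have := hcu0 γ
      have := hcv0 γ
      rw [bandProduct, sqWeight, hψ.eq_zero h0]
      simp only [ne_eq, OfNat.ofNat_ne_zero, not_false_eq_true, zero_pow, Complex.ofReal_zero,
        mul_zero, norm_zero]
      positivity

theorem locallySummable_bandProduct (hS : IsCompact S) (hΩ : IsCompact Ω)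
    (hψ : IsSmoothSupportedIn ψ Ω) (hu : IsSpectrumIn S u) (hv : IsSpectrumIn S v)
    (x : EuclideanSpace ℝ (Fin m) × ℝ) :
    LocallySummable Γ fun w => bandProduct u v ψ (w - x) := by
  intro R
  obtain ⟨M, -, hM⟩ := exists_bandProduct_bound Γ hS hΩ hψ (R := max R 0 + ‖x‖) (by positivity)
  obtain ⟨c, hc, -, hcF⟩ := hM u v hu hv
  refine ⟨c, hc, fun γ w hw => ?_⟩
  simp only [add_sub_right_comm w]
  exact hcF γ _ ((norm_sub_le _ _).trans (by gcongr; exact hw.trans (le_max_left _ _)))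

/-- The Fourier coefficients of the periodization of `bandProduct`. -/
def bandCoeff (Γ : Submodule ℤ (EuclideanSpace ℝ (Fin m) × ℝ)) (ψ : ℝ → ℝ)
    (u v : EuclideanSpace ℝ (Fin m) → ℂ) (η : EuclideanSpace ℝ (Fin m) × ℝ) : ℂ :=
  ((ZLattice.covolume Γ volume : ℝ) : ℂ)⁻¹ * 𝓕 (sqWeight ψ) η.2 * correlation u v η.1

/-- Fubini separates the physical and internal variables; the translation by `x` comes out as the
character. -/
theorem integral_exp_mul_bandProduct (hu : IsSpectrumIn S u) (hv : IsSpectrumIn S v)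
    (ψ : ℝ → ℝ) (x : EuclideanSpace ℝ (Fin m)) (η : EuclideanSpace ℝ (Fin m) × ℝ) :
    ∫ w, Complex.exp (-(2 * Real.pi * Complex.I * (pairing w η : ℂ))) *
        bandProduct u v ψ (w - (x, 0))
      = 𝓕 (sqWeight ψ) η.2 * correlation u v η.1 * character (-η.1) x := by
  have h1 : ∀ w : EuclideanSpace ℝ (Fin m) × ℝ,
      Complex.exp (-(2 * Real.pi * Complex.I * (pairing w η : ℂ))) *
        bandProduct u v ψ (w - (x, 0))
      = (Real.fourierChar (-inner ℝ w.1 η.1) •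
          (fun y => 𝓕⁻ u y * conj (𝓕⁻ v y)) (w.1 + -x)) *
        (Real.fourierChar (-(w.2 * η.2)) • sqWeight ψ w.2) := by
    intro w
    have e : Complex.exp (-(2 * Real.pi * Complex.I * (pairing w η : ℂ)))
        = Real.fourierChar (-inner ℝ w.1 η.1) * Real.fourierChar (-(w.2 * η.2)) := by
      rw [Real.fourierChar_apply, Real.fourierChar_apply, ← Complex.exp_add, pairing]
      congr 1
      push_cast
      ring
    simp only [bandProduct, Circle.smul_def, smul_eq_mul, Prod.fst_sub, Prod.snd_sub, sub_zero,
      e, ← sub_eq_add_neg]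
    ring
  simp only [h1]
  rw [Measure.volume_eq_prod, integral_prod_mul (fun y => Real.fourierChar (-inner ℝ y η.1) •
      (fun y => 𝓕⁻ u y * conj (𝓕⁻ v y)) (y + -x))
    (fun s => Real.fourierChar (-(s * η.2)) • sqWeight ψ s), ← Real.fourier_real_eq,
    ← Real.fourier_eq (fun y => (fun y => 𝓕⁻ u y * conj (𝓕⁻ v y)) (y + -x)),
    fourier_comp_add_right (fun y => 𝓕⁻ u y * conj (𝓕⁻ v y)), fourier_mul_conj_fourierInv hu.integrable hu.memLp hv.integrable
      hv.memLp]
  have e2 : character (-η.1) x = Real.fourierChar (inner ℝ (-x) η.1) := by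
    rw [character, Real.fourierChar_apply, inner_neg_left, inner_neg_left, real_inner_comm]
    congr 1
    push_cast
    ring
  rw [e2, Circle.smul_def, smul_eq_mul, correlation]
  ring

theorem norm_bandCoeff_le (Γ : Submodule ℤ (EuclideanSpace ℝ (Fin m) × ℝ)) [DiscreteTopology Γ]
    [IsZLattice ℝ Γ] (hu : IsSpectrumIn S u) (hv : IsSpectrumIn S v) {r : ℝ}
    (hr : ∀ t ∈ S, ‖t‖ ≤ r) (η : EuclideanSpace ℝ (Fin m) × ℝ) :
    ‖bandCoeff Γ ψ u v η‖ ≤ (ZLattice.covolume Γ volume)⁻¹ *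
      {η : EuclideanSpace ℝ (Fin m) × ℝ | ‖η.1‖ ≤ 2 * r}.indicator
        (fun η => ‖𝓕 (sqWeight ψ) η.2‖) η * ((∫ t, ‖u t‖ ^ 2) + ∫ t, ‖v t‖ ^ 2) := by
  have : (volume : Measure (EuclideanSpace ℝ (Fin m) × ℝ)).IsAddHaarMeasure :=
    Measure.volume_eq_prod (EuclideanSpace ℝ (Fin m)) ℝ ▸ inferInstance
  have hc := ZLattice.covolume_pos Γ (volume : Measure (EuclideanSpace ℝ (Fin m) × ℝ))
  by_cases hη : ‖η.1‖ ≤ 2 * r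
  · rw [Set.indicator_of_mem (by exact hη), bandCoeff, norm_mul, norm_mul, norm_inv,
      Complex.norm_real, Real.norm_of_nonneg hc.le]
    gcongr
    exact hu.norm_correlation_le hv _
  · rw [Set.indicator_of_notMem (by exact hη), bandCoeff, hu.correlation_eq_zero hv hr hη]
    simp

theorem hasSum_bandCoeff (hS : IsCompact S) (hΩ : IsCompact Ω) (hψ : IsSmoothSupportedIn ψ Ω)
    (hu : IsSpectrumIn S u) (hv : IsSpectrumIn S v) (x : EuclideanSpace ℝ (Fin m)) :
    HasSum (fun η : dualLattice Γ => bandCoeff Γ ψ u v η *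
        character (-(η : EuclideanSpace ℝ (Fin m) × ℝ).1) x)
      (∑' γ : Γ, bandProduct u v ψ ((γ : EuclideanSpace ℝ (Fin m) × ℝ) - (x, 0))) := by
  have : (volume : Measure (EuclideanSpace ℝ (Fin m) × ℝ)).IsAddHaarMeasure :=
    Measure.volume_eq_prod (EuclideanSpace ℝ (Fin m)) ℝ ▸ inferInstance
  have : Module.Finite ℤ Γ := ZLattice.module_finite ℝ Γ
  have : Module.Free ℤ Γ := ZLattice.module_free ℝ Γ
  let b := Module.Free.chooseBasis ℤ Γ
  obtain ⟨e, he⟩ := exists_equiv_dualLattice b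
  have hc := ZLattice.covolume_pos Γ (volume : Measure (EuclideanSpace ℝ (Fin m) × ℝ))
  have hc' : ((ZLattice.covolume Γ volume : ℝ) : ℂ) ≠ 0 := by exact_mod_cast hc.ne'
  have hint : ∀ n, ((ZLattice.covolume Γ volume : ℝ) : ℂ)⁻¹ *
      ∫ w, basisChar (b.ofZLatticeBasis ℝ) n w * bandProduct u v ψ (w - (x, 0))
      = bandCoeff Γ ψ u v (e n) * character (-(e n : EuclideanSpace ℝ (Fin m) × ℝ).1) x := by
    intro n
    simp only [basisChar, he]
    rw [integral_exp_mul_bandProduct hu hv, bandCoeff]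
    ring
  obtain ⟨r, hr0, hr⟩ := hS.isBounded.subset_closedBall_lt 0 0
  have hr' : ∀ t ∈ S, ‖t‖ ≤ r := fun t ht => by simpa using hr ht
  have hsum : Summable fun η : dualLattice Γ => bandCoeff Γ ψ u v η *
        character (-(η : EuclideanSpace ℝ (Fin m) × ℝ).1) x := by
    refine Summable.of_norm_bounded (((hψ.summable_dualLattice hΩ Γ
      (R := 2 * r) (by positivity)).mul_left (ZLattice.covolume Γ volume)⁻¹).mul_right
      ((∫ t, ‖u t‖ ^ 2) + ∫ t, ‖v t‖ ^ 2)) fun η => ?_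
    rw [norm_mul, norm_character, mul_one]
    exact norm_bandCoeff_le Γ hu hv hr' η
  have h := (locallySummable_bandProduct (Γ := Γ) hS hΩ hψ hu hv (x, 0)).hasSum_poisson
    ((continuous_bandProduct hu hv hψ).comp (continuous_sub_right _)) b volume ?_
  · simp only [hint] at h
    exact (e.hasSum_iff (f := fun η : dualLattice Γ => bandCoeff Γ ψ u v η *
        character (-(η : EuclideanSpace ℝ (Fin m) × ℝ).1) x)).1 h
  · have h2 := (e.summable_iff.2 hsum).mul_left ((ZLattice.covolume Γ volume : ℝ) : ℂ)
    refine h2.congr fun n => ?_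
    rw [Function.comp_apply, ← hint n, mul_inv_cancel_left₀ hc']

end BandLimited

/-! ### The spectra of the sampled functions -/

section Spectra

variable {m : ℕ}

/-- The Fourier transform `f̂ · conj ĝ` of the cross-correlation of `f` and `g`. -/
def crossSpectrum (f : L2 m) (g : EuclideanSpace ℝ (Fin m) → ℂ) (t : EuclideanSpace ℝ (Fin m)) : ℂ :=
  fourierL2 f t * conj (𝓕 g t)

theorem norm_fourier_le (g : EuclideanSpace ℝ (Fin m) → ℂ) (t : EuclideanSpace ℝ (Fin m)) :
    ‖𝓕 g t‖ ≤ ∫ y, ‖g y‖ :=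
  VectorFourier.norm_fourierIntegral_le_integral_norm _ _ _ _ _

theorem memLp_fourierL2 (f : L2 m) : MemLp (fourierL2 f) 2 := Lp.memLp _

theorem aestronglyMeasurable_conj_fourier {g : EuclideanSpace ℝ (Fin m) → ℂ} (hg : Integrable g) :
    AEStronglyMeasurable (fun t => conj (𝓕 g t)) volume :=
  (Complex.continuous_conj.comp (continuous_fourier hg)).aestronglyMeasurable

/-- `ĝ` is bounded because `g` is integrable, so the product inherits square integrability from
`f̂`; integrability follows on the compact set `S`. -/
theorem isSpectrumIn_crossSpectrum {f : L2 m} {g : EuclideanSpace ℝ (Fin m) → ℂ}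
    (hg : Integrable g) {S : Set (EuclideanSpace ℝ (Fin m))} (hS : IsCompact S)
    (hf : ∀ᵐ t, t ∉ S → fourierL2 f t = 0) : IsSpectrumIn S (crossSpectrum f g) := by
  have h0 : ∀ᵐ t, t ∉ S → crossSpectrum f g t = 0 := by
    filter_upwards [hf] with t ht hts
    rw [crossSpectrum, ht hts, zero_mul]
  have h2 : MemLp (crossSpectrum f g) 2 := by
    refine (memLp_fourierL2 f).of_le_mul (c := ∫ y, ‖g y‖)
      ((memLp_fourierL2 f).1.mul (aestronglyMeasurable_conj_fourier hg))
      (Eventually.of_forall fun t => ?_)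
    rw [crossSpectrum, norm_mul, RCLike.norm_conj, mul_comm]
    gcongr
    exact norm_fourier_le g t
  refine ⟨?_, h2, h0⟩
  have : IsFiniteMeasure (volume.restrict S) := isFiniteMeasure_restrict.2 hS.measure_lt_top.ne
  exact IntegrableOn.integrable_of_ae_notMem_eq_zero
    ((h2.restrict S).integrable (by norm_num)) h0

theorem l2Inner_translate (f : L2 m) {g : EuclideanSpace ℝ (Fin m) → ℂ} (h1 : Integrable g)
    (h2 : MemLp g 2) (x l : EuclideanSpace ℝ (Fin m)) :
    l2Inner (translate x f) (translate l g) = 𝓕⁻ (crossSpectrum f g) (l - x) := by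
  have e := integral_sub_right_eq_self
    (fun t => (f : EuclideanSpace ℝ (Fin m) → ℂ) t * conj (g (t + (x - l)))) x (μ := volume)
  have e' : l2Inner (translate x f) (translate l g) = ∫ t,
      (f : EuclideanSpace ℝ (Fin m) → ℂ) t * conj (g (t + (x - l))) := by
    rw [← e, l2Inner]
    simp only [translate]
    congr! 5 with t
    abel
  rw [e', integral_mul_conj_fourier_Lp f (h1.comp_add_right (x - l))
    (h2.comp_measurePreserving (measurePreserving_add_right volume (x - l))), Real.fourierInv_eq]
  refine integral_congr_ae (Eventually.of_forall fun t => ?_)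
  simp only [fourier_comp_add_right, Circle.smul_def, smul_eq_mul, map_mul, crossSpectrum,
    fourierL2]
  rw [← Circle.coe_inv_eq_conj, ← AddChar.map_neg_eq_inv, ← inner_neg_left, neg_sub,
    real_inner_comm]
  ring

theorem l2Inner_comm (F G : EuclideanSpace ℝ (Fin m) → ℂ) : l2Inner F G = conj (l2Inner G F) := by
  rw [l2Inner, l2Inner, ← integral_conj]
  simp only [map_mul, RCLike.conj_conj, mul_comm]

variable {Γ : Submodule ℤ (EuclideanSpace ℝ (Fin m) × ℝ)} {Ω : Set ℝ} {ψ : ℝ → ℝ}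

theorem seriesTerm_fst (hΓ : IsCutAndProject Γ) (f : L2 m) {g h : EuclideanSpace ℝ (Fin m) → ℂ}
    (hg : MemWiener 2 g) (hh : MemWiener 2 h) (x : EuclideanSpace ℝ (Fin m))
    {γ : EuclideanSpace ℝ (Fin m) × ℝ} (hγ : γ ∈ Γ) (hγΩ : γ.2 ∈ Ω) :
    seriesTerm Γ Ω ψ f g h x γ.1
      = bandProduct (crossSpectrum f g) (crossSpectrum f h) ψ (γ - (x, 0)) := by
  rw [seriesTerm, weight_fst hΓ hγ hγΩ, l2Inner_comm (translate γ.1 h),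
    l2Inner_translate f hg.integrable hg.memLp, l2Inner_translate f hh.integrable hh.memLp,
    bandProduct, sqWeight, Prod.fst_sub, Prod.snd_sub, sub_zero]
  ring

/-- The points of the lattice above a model set. -/
theorem exists_modelSet_lift (hΓ : IsCutAndProject Γ) (Ω : Set ℝ) :
    ∃ e : modelSet Γ Ω → Γ, Function.Injective e ∧
      (∀ l, (e l : EuclideanSpace ℝ (Fin m) × ℝ).1 = l) ∧
      ∀ γ : Γ, γ ∈ Set.range e ↔ (γ : EuclideanSpace ℝ (Fin m) × ℝ).2 ∈ Ω := by
  choose e he using fun l : modelSet Γ Ω => l.2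
  refine ⟨fun l => ⟨e l, (he l).1⟩, fun l l' h => ?_, fun l => (he l).2.2, fun γ => ⟨?_, fun h => ?_⟩⟩
  · have : e l = e l' := congrArg Subtype.val h
    exact Subtype.ext (by rw [← (he l).2.2, ← (he l').2.2, this])
  · rintro ⟨l, rfl⟩
    exact (he l).2.1
  · refine ⟨⟨(γ : EuclideanSpace ℝ (Fin m) × ℝ).1, γ, γ.2, h, rfl⟩, Subtype.ext ?_⟩
    exact hΓ.injOn_fst (he _).1 γ.2 (he _).2.2

theorem bandProduct_eq_zero (hψ : IsSmoothSupportedIn ψ Ω) (u v : EuclideanSpace ℝ (Fin m) → ℂ)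
    {w : EuclideanSpace ℝ (Fin m) × ℝ} (hw : w.2 ∉ Ω) : bandProduct u v ψ w = 0 := by
  simp [bandProduct, sqWeight, hψ.eq_zero hw]

end Spectra

/-! ### Families of generators -/

section Families

variable {m : ℕ} {K : Type*} {f : L2 m} {g h : K → EuclideanSpace ℝ (Fin m) → ℂ} {B : ℝ}
  {S : Set (EuclideanSpace ℝ (Fin m))}

/-- Integrating `|f̂|² ∑_k |ĝ_k|² ≤ B |f̂|²` bounds the total energy of the family. -/
theorem summable_integral_crossSpectrum (hg : ∀ k, IsSpectrumIn S (crossSpectrum f (g k)))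
    (hB : ∀ t, Summable (fun k => ‖𝓕 (g k) t‖ ^ 2) ∧ ∑' k, ‖𝓕 (g k) t‖ ^ 2 ≤ B) :
    Summable fun k => ∫ t, ‖crossSpectrum f (g k) t‖ ^ 2 := by
  refine summable_of_sum_le (c := ∫ t, ‖fourierL2 f t‖ ^ 2 * B)
    (fun k => integral_nonneg fun t => by positivity) fun s => ?_
  rw [← integral_finsetSum _ fun k _ => (hg k).integrable_sq]
  refine integral_mono (integrable_finsetSum _ fun k _ => (hg k).integrable_sq)
    (((memLp_fourierL2 f).integrable_norm_pow (by norm_num)).mul_const B) fun t => ?_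
  simp only [crossSpectrum, norm_mul, RCLike.norm_conj, mul_pow, ← Finset.mul_sum]
  gcongr
  exact ((hB t).1.sum_le_tsum s fun _ _ => by positivity).trans (hB t).2

theorem norm_conj_mul_le (a b : ℂ) : ‖conj a * b‖ ≤ ‖a‖ ^ 2 + ‖b‖ ^ 2 := by
  rw [norm_mul, RCLike.norm_conj]
  nlinarith [sq_nonneg (‖a‖ - ‖b‖), sq_nonneg ‖a‖, sq_nonneg ‖b‖]

theorem summable_conj_mul {a b : K → ℂ} (ha : Summable fun k => ‖a k‖ ^ 2)
    (hb : Summable fun k => ‖b k‖ ^ 2) : Summable fun k => conj (a k) * b k :=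
  Summable.of_norm_bounded (ha.add hb) fun _ => norm_conj_mul_le _ _

theorem coeffIntegrand_eq (f : L2 m) (g h : K → EuclideanSpace ℝ (Fin m) → ℂ)
    (ω t : EuclideanSpace ℝ (Fin m)) :
    coeffIntegrand (fourierL2 f) g h ω t
      = ∑' k, crossSpectrum f (g k) t * conj (crossSpectrum f (h k) (t - ω)) := by
  rw [coeffIntegrand, ← tsum_mul_left]
  refine tsum_congr fun k => ?_
  simp only [crossSpectrum, map_mul, RCLike.conj_conj]
  ring

variable [Countable K]

theorem hasSum_integral_coeffIntegrand (hg : ∀ k, IsSpectrumIn S (crossSpectrum f (g k)))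
    (hh : ∀ k, IsSpectrumIn S (crossSpectrum f (h k)))
    (hgs : Summable fun k => ∫ t, ‖crossSpectrum f (g k) t‖ ^ 2)
    (hhs : Summable fun k => ∫ t, ‖crossSpectrum f (h k) t‖ ^ 2) (ω : EuclideanSpace ℝ (Fin m)) :
    HasSum (fun k => correlation (crossSpectrum f (g k)) (crossSpectrum f (h k)) ω)
      (∫ t, coeffIntegrand (fourierL2 f) g h ω t) := by
  simp only [coeffIntegrand_eq]
  exact hasSum_integral_of_summable_integral_norm (fun k => (hg k).integrable_mul_conj (hh k) ω)
    (Summable.of_nonneg_of_le (fun k => integral_nonneg fun t => norm_nonneg _)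
      (fun k => (hg k).integral_norm_le (hh k) ω) (hgs.add hhs))

theorem integrable_coeffIntegrand (hg : ∀ k, IsSpectrumIn S (crossSpectrum f (g k)))
    (hh : ∀ k, IsSpectrumIn S (crossSpectrum f (h k))) {Bg Bh : ℝ}
    (hgB : ∀ t, Summable (fun k => ‖𝓕 (g k) t‖ ^ 2) ∧ ∑' k, ‖𝓕 (g k) t‖ ^ 2 ≤ Bg)
    (hhB : ∀ t, Summable (fun k => ‖𝓕 (h k) t‖ ^ 2) ∧ ∑' k, ‖𝓕 (h k) t‖ ^ 2 ≤ Bh)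
    (ω : EuclideanSpace ℝ (Fin m)) :
    Integrable (coeffIntegrand (fourierL2 f) g h ω) := by
  have hs : ∀ t, Summable fun k => conj (𝓕 (g k) t) * 𝓕 (h k) (t - ω) := fun t =>
    summable_conj_mul (hgB t).1 (hhB _).1
  have hf' : MemLp (fun t => conj (fourierL2 f (t - ω))) 2 :=
    ((memLp_fourierL2 f).comp_measurePreserving (measurePreserving_sub_right volume ω)).star
  refine (((memLp_fourierL2 f).integrable_mul hf').norm.mul_const (Bg + Bh)).mono' ?_
    (Eventually.of_forall fun t => ?_)
  -- The integrand is a pointwise limit of finite partial sums; countability of `K` makes the filter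
  -- on finite sets countably generated.
  · refine aestronglyMeasurable_of_tendsto_ae atTop (f := fun (s : Finset K) t =>
      ∑ k ∈ s, crossSpectrum f (g k) t * conj (crossSpectrum f (h k) (t - ω)))
      (fun s => Finset.aestronglyMeasurable_fun_sum s fun k _ =>
        ((hg k).integrable_mul_conj (hh k) ω).1) (Eventually.of_forall fun t => ?_)
    rw [coeffIntegrand_eq]
    refine Summable.hasSum (((hs t).mul_left (fourierL2 f t * conj (fourierL2 f (t - ω)))).congr
      fun k => ?_)
    simp only [crossSpectrum, map_mul, RCLike.conj_conj]
    ring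
  · rw [coeffIntegrand, norm_mul]
    refine mul_le_mul_of_nonneg_left ?_ (norm_nonneg _)
    refine (tsum_of_norm_bounded ((hgB t).1.hasSum.add (hhB (t - ω)).1.hasSum)
      fun k => norm_conj_mul_le _ _).trans (add_le_add (hgB t).2 (hhB _).2)

end Families

theorem summable_norm_tsum {I K : Type*} {a : I × K → ℂ} (ha : Summable fun q => ‖a q‖) :
    Summable fun i => ‖∑' k, a (i, k)‖ :=
  ha.prod.of_nonneg_of_le (fun _ => norm_nonneg _) fun i =>
    norm_tsum_le_tsum_norm (ha.prod_factor i)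

/-! ### Poisson summation summed over the family -/

section BandLimitedFamilies

variable {m : ℕ} {K : Type*} {S : Set (EuclideanSpace ℝ (Fin m))} {ψ : ℝ → ℝ} {Ω : Set ℝ}
  {Γ : Submodule ℤ (EuclideanSpace ℝ (Fin m) × ℝ)} [DiscreteTopology Γ] [IsZLattice ℝ Γ]
  {u v : K → EuclideanSpace ℝ (Fin m) → ℂ}

theorem summable_bandProduct (hS : IsCompact S) (hΩ : IsCompact Ω) (hψ : IsSmoothSupportedIn ψ Ω)
    (hu : ∀ k, IsSpectrumIn S (u k)) (hv : ∀ k, IsSpectrumIn S (v k))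
    (hus : Summable fun k => ∫ t, ‖u k t‖ ^ 2) (hvs : Summable fun k => ∫ t, ‖v k t‖ ^ 2)
    (x : EuclideanSpace ℝ (Fin m)) :
    Summable fun q : K × Γ =>
      bandProduct (u q.1) (v q.1) ψ ((q.2 : EuclideanSpace ℝ (Fin m) × ℝ) - (x, 0)) := by
  obtain ⟨M, -, hM⟩ := exists_bandProduct_bound Γ hS hΩ hψ
    (norm_nonneg (-(x, 0) : EuclideanSpace ℝ (Fin m) × ℝ))
  choose c hc hcM hcF using fun k => hM (u k) (v k) (hu k) (hv k)
  have hle : ∀ k (γ : Γ), ‖bandProduct (u k) (v k) ψ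
      ((γ : EuclideanSpace ℝ (Fin m) × ℝ) - (x, 0))‖ ≤ c k γ := fun k γ => by
    rw [sub_eq_neg_add]
    exact hcF k γ _ le_rfl
  have hsum : ∀ k, Summable fun γ : Γ => ‖bandProduct (u k) (v k) ψ
      ((γ : EuclideanSpace ℝ (Fin m) × ℝ) - (x, 0))‖ := fun k =>
    Summable.of_nonneg_of_le (fun _ => norm_nonneg _) (hle k) (hc k)
  refine Summable.of_norm ((summable_prod_of_nonneg fun _ => norm_nonneg _).2 ⟨hsum, ?_⟩)
  exact Summable.of_nonneg_of_le (fun k => tsum_nonneg fun _ => norm_nonneg _)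
    (fun k => ((hsum k).tsum_le_tsum (hle k) (hc k)).trans (hcM k)) ((hus.add hvs).mul_left M)

theorem summable_bandCoeff (hS : IsCompact S) (hΩ : IsCompact Ω) (hψ : IsSmoothSupportedIn ψ Ω)
    (hu : ∀ k, IsSpectrumIn S (u k)) (hv : ∀ k, IsSpectrumIn S (v k))
    (hus : Summable fun k => ∫ t, ‖u k t‖ ^ 2) (hvs : Summable fun k => ∫ t, ‖v k t‖ ^ 2) :
    Summable fun q : dualLattice Γ × K => ‖bandCoeff Γ ψ (u q.2) (v q.2) q.1‖ := by
  obtain ⟨r, hr0, hr⟩ := hS.isBounded.subset_closedBall_lt 0 0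
  have : (volume : Measure (EuclideanSpace ℝ (Fin m) × ℝ)).IsAddHaarMeasure :=
    Measure.volume_eq_prod (EuclideanSpace ℝ (Fin m)) ℝ ▸ inferInstance
  have hc := ZLattice.covolume_pos Γ (volume : Measure (EuclideanSpace ℝ (Fin m) × ℝ))
  have h1 := (hψ.summable_dualLattice hΩ Γ (R := 2 * r) (by positivity)).mul_left
    (ZLattice.covolume Γ volume)⁻¹
  have h2 := hus.add hvs
  have h3 := h1.mul_of_nonneg h2
    (fun η => mul_nonneg (inv_nonneg.2 hc.le) (Set.indicator_nonneg (fun _ _ => norm_nonneg _) _))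
    (fun k => add_nonneg (integral_nonneg fun _ => by positivity)
      (integral_nonneg fun _ => by positivity))
  exact h3.of_nonneg_of_le (fun _ => norm_nonneg _) fun q =>
    norm_bandCoeff_le Γ (hu q.2) (hv q.2) (fun t ht => by simpa using hr ht) q.1

theorem hasSum_tsum_bandCoeff (hS : IsCompact S) (hΩ : IsCompact Ω)
    (hψ : IsSmoothSupportedIn ψ Ω)
    (hu : ∀ k, IsSpectrumIn S (u k)) (hv : ∀ k, IsSpectrumIn S (v k))
    (hus : Summable fun k => ∫ t, ‖u k t‖ ^ 2) (hvs : Summable fun k => ∫ t, ‖v k t‖ ^ 2)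
    (x : EuclideanSpace ℝ (Fin m)) :
    HasSum (fun η : dualLattice Γ => (∑' k, bandCoeff Γ ψ (u k) (v k) η) *
        character (-(η : EuclideanSpace ℝ (Fin m) × ℝ).1) x)
      (∑' k, ∑' γ : Γ, bandProduct (u k) (v k) ψ
        ((γ : EuclideanSpace ℝ (Fin m) × ℝ) - (x, 0))) := by
  have hs : Summable fun q : dualLattice Γ × K => bandCoeff Γ ψ (u q.2) (v q.2) q.1 *
      character (-(q.1 : EuclideanSpace ℝ (Fin m) × ℝ).1) x :=
    Summable.of_norm_bounded (summable_bandCoeff hS hΩ hψ hu hv hus hvs) fun q => by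
      rw [norm_mul, norm_character, mul_one]
  have h := hs.prod.hasSum
  -- Absolute summability over `Γ* × K` lets the sum over `k` be taken last, so that Poisson
  -- summation applies to each `k`.
  rw [← hs.tsum_comm] at h
  simp only [tsum_mul_right] at h
  simpa only [fun k => (hasSum_bandCoeff (Γ := Γ) hS hΩ hψ (hu k) (hv k) x).tsum_eq] using h

end BandLimitedFamilies

end ModelSetFrames

end

/-! ### Assembly of the proposition -/

open ModelSetFrames in
theorem proposition3p5 {m : ℕ} {K : Type*} [Countable K]
    (Γ : Submodule ℤ (EuclideanSpace ℝ (Fin m) × ℝ)) [DiscreteTopology Γ] [IsZLattice ℝ Γ]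
    (hΓ : IsCutAndProject Γ)
    (Ω : Set ℝ) (hΩ : IsSymmetricSimpleWindow Ω)
    (ψ : ℝ → ℝ) (hψ : IsSmoothSupportedIn ψ Ω) (hψ_nonneg : ∀ s, 0 ≤ ψ s)
    (g h : K → EuclideanSpace ℝ (Fin m) → ℂ)
    (hg : ∀ k, MemWiener 2 (g k)) (hh : ∀ k, MemWiener 2 (h k))
    (Bg Bh : ℝ) (hBg : 0 < Bg) (hBh : 0 < Bh)
    (hgB : ∀ t, Summable (fun k => ‖𝓕 (g k) t‖ ^ 2) ∧ ∑' k, ‖𝓕 (g k) t‖ ^ 2 ≤ Bg)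
    (hhB : ∀ t, Summable (fun k => ‖𝓕 (h k) t‖ ^ 2) ∧ ∑' k, ‖𝓕 (h k) t‖ ^ 2 ≤ Bh)
    (f : L2 m) (hf : MemD f) :
    -- the series defining the function converges absolutely at every point
    (∀ x, Summable (fun q : K × modelSet Γ Ω => seriesTerm Γ Ω ψ f (g q.1) (h q.1) x q.2)) ∧
    AlmostPeriodic (weightedFun Γ Ω ψ f g h) ∧
    -- the sums over `k` and the integrals in the coefficients converge absolutely
    (∀ η ∈ dualLattice Γ,
      (∀ t, Summable (fun k => conj (𝓕 (g k) t) * 𝓕 (h k) (t - η.1))) ∧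
      Integrable
        (coeffIntegrand (fourierL2 f) g h η.1) volume) ∧
    -- `coeff` gives the Fourier coefficients, and there are no other frequencies
    (∀ η ∈ dualLattice Γ,
      HasFourierCoeff (weightedFun Γ Ω ψ f g h) η.1
        (coeff Γ ψ (fourierL2 f) g h η)) ∧
    (∀ ω, ω ∉ Prod.fst '' dualLattice Γ →
      HasFourierCoeff (weightedFun Γ Ω ψ f g h) ω 0) ∧
    -- the function equals its Fourier series at every point
    (∀ x, HasSum
      (fun η : dualLattice Γ =>
        coeff Γ ψ (fourierL2 f) g h η *
          character (-(η : EuclideanSpace ℝ (Fin m) × ℝ).1) x)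
      (weightedFun Γ Ω ψ f g h x)) := by
  obtain ⟨-, S, hS, hfS⟩ := hf
  have hu : ∀ k, IsSpectrumIn S (crossSpectrum f (g k)) := fun k =>
    isSpectrumIn_crossSpectrum (hg k).integrable hS hfS
  have hv : ∀ k, IsSpectrumIn S (crossSpectrum f (h k)) := fun k =>
    isSpectrumIn_crossSpectrum (hh k).integrable hS hfS
  have hus := summable_integral_crossSpectrum hu hgB
  have hvs := summable_integral_crossSpectrum hv hhB
  obtain ⟨e, he, he1, he2⟩ := exists_modelSet_lift hΓ Ω
  have hterm : ∀ x k (l : modelSet Γ Ω), seriesTerm Γ Ω ψ f (g k) (h k) x l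
      = bandProduct (crossSpectrum f (g k)) (crossSpectrum f (h k)) ψ
        ((e l : EuclideanSpace ℝ (Fin m) × ℝ) - (x, 0)) := fun x k l => by
    rw [← seriesTerm_fst hΓ f (hg k) (hh k) x (e l).2 ((he2 _).1 ⟨l, rfl⟩), he1]
  have hfun : ∀ x, weightedFun Γ Ω ψ f g h x = ∑' k, ∑' γ : Γ,
      bandProduct (crossSpectrum f (g k)) (crossSpectrum f (h k)) ψ
        ((γ : EuclideanSpace ℝ (Fin m) × ℝ) - (x, 0)) := fun x => by
    refine tsum_congr fun k => ?_
    simp only [hterm]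
    -- Lattice points that do not lie above the model set have second coordinate outside `Ω`, where
    -- the weight vanishes.
    refine he.tsum_eq (f := fun γ : Γ => bandProduct (crossSpectrum f (g k))
      (crossSpectrum f (h k)) ψ ((γ : EuclideanSpace ℝ (Fin m) × ℝ) - (x, 0))) fun γ hγ => ?_
    by_contra hne
    refine hγ (bandProduct_eq_zero hψ _ _ ?_)
    rw [Prod.snd_sub, sub_zero]
    exact fun h => hne ((he2 γ).2 h)
  have hcoeff : ∀ η, coeff Γ ψ (fourierL2 f) g h η
      = ∑' k, bandCoeff Γ ψ (crossSpectrum f (g k)) (crossSpectrum f (h k)) η := fun η =>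
    ((hasSum_integral_coeffIntegrand hu hv hus hvs η.1).mul_left _).tsum_eq.symm
  have hseries : ∀ x, HasSum (fun η : dualLattice Γ => coeff Γ ψ (fourierL2 f) g h η *
      character (-(η : EuclideanSpace ℝ (Fin m) × ℝ).1) x) (weightedFun Γ Ω ψ f g h x) := fun x => by
    simp only [hcoeff, hfun]
    exact hasSum_tsum_bandCoeff hS hΩ.isCompact hψ hu hv hus hvs x
  have hnorm : Summable fun η : dualLattice Γ => ‖coeff Γ ψ (fourierL2 f) g h η‖ := by
    have hs := summable_norm_tsum (summable_bandCoeff (Γ := Γ) hS hΩ.isCompact hψ hu hv hus hvs)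
    exact hs.congr fun η => by rw [hcoeff]
  have hF : weightedFun Γ Ω ψ f g h = fun x => ∑' η : dualLattice Γ,
      coeff Γ ψ (fourierL2 f) g h η * character (-(η : EuclideanSpace ℝ (Fin m) × ℝ).1) x :=
    funext fun x => (hseries x).tsum_eq.symm
  have hFC := hF ▸ hasFourierCoeff_tsum hnorm fun η => (η : EuclideanSpace ℝ (Fin m) × ℝ).1
  refine ⟨fun x => ?_, hF ▸ almostPeriodic_tsum hΓ hnorm, fun η _ => ⟨fun t => ?_, ?_⟩,
    fun η hη => ?_, fun ω hω => ?_, hseries⟩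
  · have hs := (summable_bandProduct (Γ := Γ) hS hΩ.isCompact hψ hu hv hus hvs x).comp_injective
      (Function.injective_id.prodMap he)
    exact hs.congr fun q => (hterm x q.1 q.2).symm
  · exact summable_conj_mul (hgB t).1 (hhB _).1
  · exact integrable_coeffIntegrand hu hv hgB hhB η.1
  · have := hFC η.1
    -- Injectivity of `p₁*` leaves a single dual point at this frequency.
    rwa [tsum_eq_single ⟨η, hη⟩ fun η' hne => by
      rw [if_neg fun h => hne (dualLattice_fst_injective hΓ h), mul_zero], if_pos rfl,
      mul_one] at this
  · have := hFC ω
    rwa [tsum_congr (g := fun _ => 0) fun η => by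
      rw [if_neg fun h => hω ⟨η, η.2, h⟩, mul_zero], tsum_zero] at this
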